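/- **Setting.** Let $\ell\in\{0,1,2,\dots\}\cup\{\infty\}$, and let $X$ be the minimal continuous-time Markov process on the states $(m,i)$ with level $m\in\{\dots,-2,-1,0\}$ and phase $0\le i\le\ell$ ($i<\infty$), whose generator $Q$ is level-homogeneous and skip-free to the left: from level $k$ to level $l$ the rates are given by a matrix $D=(d_{ij})$ if $l=k-1$; by $W=(w_{ij})$ if $l=k<0$; by $U^{l-k}=(u^{l-k}_{ij})$ if $k<l<0$; by $W'$ if $k=l=0$; by $U^{(-k)'}$ if $k<l=0$; and are $0$ if $l<k-1$. Assume that $Q$ is a stable, conservative $q$-matrix (finite entries, nonnegative off-diagonal entries, zero row sums), that it is irreducible, and that $D+W+\sum_{s\ge1}U^s$ has zero row sums as well (equivalently, $U^{k'}$ has the same row sums as $\sum_{s\ge k}U^s$ for every $k\ge 1$). Assume that $X$ has a stationary distribution $\pi$ (a probability vector with $\pi P_t=\pi$ for all $t\ge0$, where $P_t$ is the transition function of $X$). A state $x\in M$ is an *exit state* of a set $M$ of states if $\sum_{z\notin M}q_{yz}=0$ for all $y\in M\setminus\{x\}$ and $\sum_{z\notin M}q_{xz}>0$. Assume that for every $m\le0$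 the state $(m,0)$ is an exit state of the super-level set $\{(k,i):k\ge m\}$. For $0\le i,j\le\ell$, $m<0$ and $k<m$ put $$\check q_{ij}=w_{ij}+\sum_{s=1}^\infty\sum_{r=0}^\ell u^s_{ir}\frac{d_{0j}}{\sum_{v=0}^\ell d_{0v}},\qquad \check a_{(k,i)(m,j)}=u^{m-k}_{ij}+\sum_{s=m+1-k}^\infty\sum_{r=0}^\ell u^s_{ir}\frac{d_{0j}}{\sum_{v=0}^\ell d_{0v}} .$$ **Theorem.** The matrix $\check Q=(\check q_{ij})$ has a two-sided inverse $\check Q^{-1}=-\check T$, where $\check T_{ij}<\infty$ is the expected total time that the minimal process with $q$-matrix $\check Q$, started in $i$, spends in $j$; if $\ell<\infty$, it is the only two-sided inverse of $\check Q$. For every level $m<0$ the entries of $R:=-\check A\check Q^{-1}$, where $\check A=(\check a_{(k,i)(m,j)})_{k<m}$, are given by absolutely convergent sums, and $$\pi_m=\tilde\pi_{m-1}R ,$$ where $\pi_m=(\pi_{(m,j)})_{0\le j\le\ell}$ and $\tilde\pi_{m-1}=(\pi_{(k,i)})_{k\le m-1,\,0\le i\le\ell}$ is the restriction of $\pi$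 to the sub-level set of levels at most $m-1$. -/

import Mathlib

open scoped ENNReal

/-! ### Continuous-time Markov processes on a countable state space, given by a `q`-matrix -/

section QMatrix

variable {S : Type}

/-- A stable, conservative `q`-matrix: the entries are real (so all rates are finite), the
off-diagonal entries are nonnegative, and every row sums to zero. -/
def IsConservativeQMatrix (q : S → S → ℝ) : Prop :=
  (∀ x y, x ≠ y → 0 ≤ q x y) ∧ ∀ x, HasSum (fun y => q x y) 0

/-- Every state can be reached from every state by jumps of positive rate. -/
def IsIrreducibleQMatrix (q : S → S → ℝ) : Prop :=
  ∀ x y, Relation.ReflTransGen (fun a b => a ≠ b ∧ 0 < q a b) x y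

open Classical in
/-- Feller's iteration: the probability that the process with (possibly non-conservative)
`q`-matrix `q`, started in `x`, is in `y` at time `t` after fewer than `n` jumps. -/
noncomputable def transitionIter (q : S → S → ℝ) : ℕ → ℝ → S → S → ℝ≥0∞
  | 0, _, _, _ => 0
  | n + 1, t, x, y =>
      (if x = y then ENNReal.ofReal (Real.exp (q x x * t)) else 0) +
        ∫⁻ s in Set.Icc 0 t, ENNReal.ofReal (Real.exp (q x x * s)) *
          ∑' z, (if z = x then 0 else ENNReal.ofReal (q x z)) * transitionIter q n (t - s) z y

/-- The transition function `P_t(x,y)` of the minimal process with `q`-matrix `q`. -/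
noncomputable def minimalTransition (q : S → S → ℝ) (t : ℝ) (x y : S) : ℝ≥0∞ :=
  ⨆ n, transitionIter q n t x y

/-- The expected total time `∫₀^∞ P_t(x,y) dt` that the minimal process with `q`-matrix `q`,
started in `x`, spends in `y`. -/
noncomputable def meanSojourn (q : S → S → ℝ) (x y : S) : ℝ≥0∞ :=
  ∫⁻ t in Set.Ioi (0 : ℝ), minimalTransition q t x y

/-- `p` is a stationary distribution of the minimal process with `q`-matrix `q`. -/
def IsStationaryDistribution (q : S → S → ℝ) (p : S → ℝ) : Prop :=
  (∀ x, 0 ≤ p x) ∧ HasSum p 1 ∧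
    ∀ t : ℝ, 0 ≤ t → ∀ y,
      ∑' x, ENNReal.ofReal (p x) * minimalTransition q t x y = ENNReal.ofReal (p y)

/-- `x` is an exit state for the set `M`: it is the only state of `M` from which `M` can be
left by one jump. -/
def IsExitState (q : S → S → ℝ) (M : Set S) (x : S) : Prop :=
  x ∈ M ∧ (∀ y ∈ M, y ≠ x → ∑' z : (Mᶜ : Set S), q y z = 0) ∧
    0 < ∑' z : (Mᶜ : Set S), q x z

open Classical in
/-- `N` is a two-sided inverse of the (finite or countably infinite) matrix `A`. -/
def IsMatrixInverse (A N : S → S → ℝ) : Prop :=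
  (∀ i j, HasSum (fun k => A i k * N k j) (if i = j then 1 else 0)) ∧
    ∀ i j, HasSum (fun k => N i k * A k j) (if i = j then 1 else 0)

/-- The inverse of the `q`-matrix of a transient process: minus the matrix of expected sojourn
times. (For a finite matrix this is the usual inverse; for an infinite one it selects the
probabilistically meaningful inverse.) -/
noncomputable def qInverse (q : S → S → ℝ) (i j : S) : ℝ :=
  -(meanSojourn q i j).toReal

end QMatrix

/-! ### Level-homogeneous quasi-skip-free processes -/

/-- The phases `0, 1, …, ℓ`; `ℓ = ⊤` means countably many phases. -/
abbrev Phase (ℓ : ℕ∞) : Type := {i : ℕ // (i : ℕ∞) ≤ ℓ}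

/-- The phase `0`. -/
def Phase.zero (ℓ : ℕ∞) : Phase ℓ := ⟨0, by simp⟩

/-- The states `(m, i)`, with level `m ∈ {…, -2, -1, 0}` and phase `i ∈ {0, …, ℓ}`. -/
abbrev QSFState (ℓ : ℕ∞) : Type := {m : ℤ // m ≤ 0} × Phase ℓ

/-- The blocks of a level-homogeneous generator that is skip-free to the left. `U s` and `U' s`
are used for `s ≥ 1` only; `W'` and `U'` are the boundary blocks of transitions to level `0`. -/
structure QSFBlocks (ℓ : ℕ∞) where
  D : Phase ℓ → Phase ℓ → ℝ
  W : Phase ℓ → Phase ℓ → ℝ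
  U : ℕ → Phase ℓ → Phase ℓ → ℝ
  W' : Phase ℓ → Phase ℓ → ℝ
  U' : ℕ → Phase ℓ → Phase ℓ → ℝ

namespace QSFBlocks

variable {ℓ : ℕ∞} (B : QSFBlocks ℓ)

/-- The generator: from level `k` to level `l` the rates are given by `D` if `l = k - 1`; by `W`
if `l = k < 0`; by `U^{l-k}` if `k < l < 0`; by `W'` if `k = l = 0`; by `U'^{-k}` if
`k < l = 0`; and there are no transitions if `l < k - 1`. -/
def generator (x y : QSFState ℓ) : ℝ :=
  if y.1.1 < x.1.1 - 1 then 0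
  else if y.1.1 = x.1.1 - 1 then B.D x.2 y.2
  else if y.1.1 = 0 then
    if x.1.1 = 0 then B.W' x.2 y.2 else B.U' (-x.1.1).toNat x.2 y.2
  else if y.1.1 = x.1.1 then B.W x.2 y.2
  else B.U (y.1.1 - x.1.1).toNat x.2 y.2

/-- The homogeneous part is conservative: `D + W + U^1 + U^2 + ⋯` has row sums zero. -/
def HomogeneousConservative : Prop :=
  ∀ i, HasSum (fun s : ℕ => ∑' r, B.U (s + 1) i r) (-((∑' r, B.D i r) + ∑' r, B.W i r))

/-- The super-level set of all states of level at least `m`. -/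
def superLevel (ℓ : ℕ∞) (m : ℤ) : Set (QSFState ℓ) := {x | m ≤ x.1.1}

/-- The sub-level set of all states of level at most `m`. -/
def subLevel (ℓ : ℕ∞) (m : ℤ) : Set (QSFState ℓ) := {x | x.1.1 ≤ m}

/-- `d_{0j} / ∑_v d_{0v}`. -/
noncomputable def entrance (j : Phase ℓ) : ℝ :=
  B.D (Phase.zero ℓ) j / ∑' v, B.D (Phase.zero ℓ) v

/-- `q̌_{ij} = w_{ij} + ∑_{s ≥ 1} ∑_r u^s_{ir} d_{0j} / ∑_v d_{0v}`. -/
noncomputable def Qcheck (i j : Phase ℓ) : ℝ :=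
  B.W i j + ∑' s : ℕ, ∑' r, B.U (1 + s) i r * B.entrance j

/-- `ǎ_{(k,i)(m,j)} = u^{m-k}_{ij} + ∑_{s ≥ m+1-k} ∑_r u^s_{ir} d_{0j} / ∑_v d_{0v}` for
`k ≤ m - 1`. -/
noncomputable def Acheck (m : ℤ) (x : subLevel ℓ (m - 1)) (j : Phase ℓ) : ℝ :=
  B.U (m - x.1.1.1).toNat x.1.2 j +
    ∑' s : ℕ, ∑' r, B.U ((m + 1 - x.1.1.1).toNat + s) x.1.2 r * B.entrance j

/-- `R = -Ǎ Q̌⁻¹`. -/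
noncomputable def rateMatrix (m : ℤ) (x : subLevel ℓ (m - 1)) (j : Phase ℓ) : ℝ :=
  -∑' i, B.Acheck m x i * qInverse B.Qcheck i j

end QSFBlocks

/-! A jump out of a super-level set always starts from phase `0`, so a level is entered from above
with the fixed law `d₀ⱼ / ∑ᵥ d₀ᵥ`. Hence the excursions of `X` above level `m`, watched only while
in level `m`, form a process with `q`-matrix `Q̌`, and the matrix `Ǎ` collects the rates at which
states of lower levels start such excursions. It follows that the expected time spent in `(m, j)`
between two visits to the levels below `m`, times the rate at which a lower state `x` is left, is
the entry `R x j`. For a recurrent process, summing these entries against the invariant measure `π`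
restricted to the levels below `m` gives `π (m, j)`.

Expected sojourn times are treated in `ℝ≥0∞` as Green functions of the jump rates, that is, as the
minimal solutions of the backward equation; for the process killed when it leaves the super-level
set, recurrence excludes any other bounded solution, so the one built from `Q̌` has to be the
Green function. -/

section Green

variable {S : Type*}

lemma tsum_iSup_nat_of_monotone (f : ℕ → S → ℝ≥0∞) (hf : Monotone f) :
    ∑' z, ⨆ n, f n z = ⨆ n, ∑' z, f n z := by
  let _ : MeasurableSpace S := ⊤
  have : MeasurableSingletonClass S := ⟨fun _ => trivial⟩
  simp only [← MeasureTheory.lintegral_count]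
  exact MeasureTheory.lintegral_iSup (fun n => measurable_from_top) hf

open Classical in
/-- The Kronecker delta, with values in the extended nonnegative reals. -/
noncomputable def kronecker (x y : S) : ℝ≥0∞ := if x = y then 1 else 0

@[simp]
lemma kronecker_self (x : S) : kronecker x x = 1 := if_pos rfl

lemma kronecker_of_ne {x y : S} (h : x ≠ y) : kronecker x y = 0 := if_neg h

lemma kronecker_comm (x y : S) : kronecker x y = kronecker y x := by
  obtain rfl | h := eq_or_ne x y
  · rfl
  · rw [kronecker_of_ne h, kronecker_of_ne h.symm]

lemma kronecker_ne_top (x y : S) : kronecker x y ≠ ⊤ := by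
  unfold kronecker
  split_ifs
  exacts [ENNReal.one_ne_top, ENNReal.zero_ne_top]

open Classical in
lemma toReal_kronecker (x y : S) : (kronecker x y).toReal = if x = y then 1 else 0 := by
  rw [kronecker, apply_ite ENNReal.toReal, ENNReal.toReal_one, ENNReal.toReal_zero]

lemma kronecker_mul_comm (f : S → ℝ≥0∞) (x y : S) :
    kronecker x y * f x = kronecker x y * f y := by
  obtain rfl | h := eq_or_ne x y
  · rfl
  · simp only [kronecker_of_ne h, zero_mul]

lemma tsum_mul_kronecker (f : S → ℝ≥0∞) (y : S) : ∑' x, f x * kronecker x y = f y := by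
  rw [tsum_eq_single y fun x hx => by rw [kronecker_of_ne hx, mul_zero], kronecker_self, mul_one]

lemma tsum_kronecker_mul (f : S → ℝ≥0∞) (x : S) : ∑' y, kronecker x y * f y = f x := by
  rw [tsum_eq_single x fun y hy => by rw [kronecker_of_ne hy.symm, zero_mul], kronecker_self,
    one_mul]

/-- The expected time spent in `y` before the `n`-th jump by the process started in `x` which
jumps from `x` to `z` at rate `a x z` and leaves `x`, by a jump or by being killed, at total rate
`q x`. -/
noncomputable def greenIter (a : S → S → ℝ≥0∞) (q : S → ℝ≥0∞) : ℕ → S → S → ℝ≥0∞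
  | 0, _, _ => 0
  | n + 1, x, y => (kronecker x y + ∑' z, a x z * greenIter a q n z y) * (q x)⁻¹

/-- The Green function: the expected total time spent in `y` by the process with jump rates `a`
and exit rates `q` started in `x`. -/
noncomputable def green (a : S → S → ℝ≥0∞) (q : S → ℝ≥0∞) (x y : S) : ℝ≥0∞ :=
  ⨆ n, greenIter a q n x y

/-- A process is recurrent if it spends an infinite expected time in each state it starts from. -/
def IsRecurrent (a : S → S → ℝ≥0∞) (q : S → ℝ≥0∞) : Prop := ∀ x, green a q x x = ⊤

/-- Every state can be reached from every state by jumps of positive rate. -/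
def IsIrreducibleRate (a : S → S → ℝ≥0∞) : Prop :=
  ∀ x y, Relation.ReflTransGen (fun b c => a b c ≠ 0) x y

variable {a : S → S → ℝ≥0∞} {q : S → ℝ≥0∞}

lemma greenIter_le_succ (n : ℕ) (x y : S) : greenIter a q n x y ≤ greenIter a q (n + 1) x y := by
  induction n generalizing x with
  | zero => exact zero_le
  | succ n ih =>
    unfold greenIter
    gcongr with z
    exact ih z

lemma greenIter_mono (x y : S) : Monotone fun n => greenIter a q n x y :=
  monotone_nat_of_le_succ fun n => greenIter_le_succ n x y

lemma green_eq_iSup_succ (x y : S) : green a q x y = ⨆ n, greenIter a q (n + 1) x y :=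
  ((greenIter_mono x y).iSup_nat_add 1).symm

lemma greenIter_backward (h0 : ∀ x, q x ≠ 0) (ht : ∀ x, q x ≠ ⊤) (n : ℕ) (x y : S) :
    q x * greenIter a q (n + 1) x y = kronecker x y + ∑' z, a x z * greenIter a q n z y := by
  rw [greenIter, mul_comm, mul_assoc, ENNReal.inv_mul_cancel (h0 x) (ht x), mul_one]

lemma green_backward (h0 : ∀ x, q x ≠ 0) (ht : ∀ x, q x ≠ ⊤) (x y : S) :
    q x * green a q x y = kronecker x y + ∑' z, a x z * green a q z y := by
  rw [green_eq_iSup_succ, ENNReal.mul_iSup]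
  simp only [greenIter_backward h0 ht]
  rw [← ENNReal.add_iSup, ← tsum_iSup_nat_of_monotone]
  · simp only [green, ENNReal.mul_iSup]
  · exact fun m n hmn z => mul_le_mul_right (greenIter_mono z y hmn) _

lemma greenIter_succ_forward (n : ℕ) (x y : S) :
    greenIter a q (n + 1) x y =
      (kronecker x y + ∑' z, greenIter a q n x z * a z y) * (q y)⁻¹ := by
  induction n generalizing x with
  | zero =>
    simp only [greenIter, mul_zero, zero_mul, tsum_zero, add_zero]
    exact kronecker_mul_comm (fun z => (q z)⁻¹) x y
  | succ n ih =>
    have hswap : ∑' z, a x z * (kronecker z y + ∑' w, greenIter a q n z w * a w y) =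
        ∑' w, (kronecker x w + ∑' z, a x z * greenIter a q n z w) * a w y := by
      simp only [mul_add, add_mul, ENNReal.tsum_add, tsum_mul_kronecker, tsum_kronecker_mul,
        ← ENNReal.tsum_mul_left, ← ENNReal.tsum_mul_right, mul_assoc]
      rw [ENNReal.tsum_comm]
    rw [greenIter]
    simp only [ih, ← mul_assoc (a x _), ENNReal.tsum_mul_right]
    rw [hswap, add_mul, kronecker_mul_comm (fun z => (q z)⁻¹), mul_right_comm, ← add_mul,
      ← ENNReal.tsum_mul_right]
    simp only [greenIter, mul_right_comm _ (q x)⁻¹]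

lemma greenIter_forward (h0 : ∀ x, q x ≠ 0) (ht : ∀ x, q x ≠ ⊤) (n : ℕ) (x y : S) :
    greenIter a q (n + 1) x y * q y = kronecker x y + ∑' z, greenIter a q n x z * a z y := by
  rw [greenIter_succ_forward, mul_assoc, ENNReal.inv_mul_cancel (h0 y) (ht y), mul_one]

lemma green_forward (h0 : ∀ x, q x ≠ 0) (ht : ∀ x, q x ≠ ⊤) (x y : S) :
    green a q x y * q y = kronecker x y + ∑' z, green a q x z * a z y := by
  rw [green_eq_iSup_succ, ENNReal.iSup_mul]
  simp only [greenIter_forward h0 ht]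
  rw [← ENNReal.add_iSup, ← tsum_iSup_nat_of_monotone]
  · simp only [green, ENNReal.iSup_mul]
  · exact fun m n hmn z => mul_le_mul_left (greenIter_mono x z hmn) _

lemma tsum_mul_green_forward (h0 : ∀ x, q x ≠ 0) (ht : ∀ x, q x ≠ ⊤) (b : S → ℝ≥0∞) (y : S) :
    (∑' x, b x * green a q x y) * q y = b y + ∑' z, (∑' x, b x * green a q x z) * a z y := by
  simp only [← ENNReal.tsum_mul_right, mul_assoc, green_forward h0 ht, mul_add, ENNReal.tsum_add,
    ← ENNReal.tsum_mul_left, tsum_mul_kronecker]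
  rw [ENNReal.tsum_comm]

lemma mul_green_le_of_superharmonic (h0 : ∀ x, q x ≠ 0) (ht : ∀ x, q x ≠ ⊤) {v : S → ℝ≥0∞}
    {c : ℝ≥0∞} {y : S} (hv : ∀ x, c * kronecker x y + ∑' z, a x z * v z ≤ q x * v x) (x : S) :
    c * green a q x y ≤ v x := by
  rw [green, ENNReal.mul_iSup]
  refine iSup_le fun n => ?_
  induction n generalizing x with
  | zero => simp only [greenIter, mul_zero, zero_le]
  | succ n ih =>
    refine (ENNReal.mul_le_mul_iff_right (h0 x) (ht x)).1 (le_trans ?_ (hv x))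
    rw [mul_left_comm, greenIter_backward h0 ht, mul_add, ← ENNReal.tsum_mul_left]
    simp only [mul_left_comm c]
    gcongr with z
    exact ih z

lemma tsum_mul_green_le_of_superinvariant (h0 : ∀ x, q x ≠ 0) (ht : ∀ x, q x ≠ ⊤)
    {b v : S → ℝ≥0∞} (hv : ∀ y, b y + ∑' x, v x * a x y ≤ v y * q y) (y : S) :
    ∑' x, b x * green a q x y ≤ v y := by
  simp only [green, ENNReal.mul_iSup]
  rw [tsum_iSup_nat_of_monotone (fun n x => b x * greenIter a q n x y)
    fun m n hmn z => mul_le_mul_right (greenIter_mono z y hmn) _]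
  refine iSup_le fun n => ?_
  induction n generalizing y with
  | zero => simp only [greenIter, mul_zero, tsum_zero, zero_le]
  | succ n ih =>
    refine (ENNReal.mul_le_mul_iff_left (h0 y) (ht y)).1 (le_trans ?_ (hv y))
    simp only [← ENNReal.tsum_mul_right, mul_assoc, greenIter_forward h0 ht, mul_add,
      ENNReal.tsum_add, ← ENNReal.tsum_mul_left, tsum_mul_kronecker]
    rw [ENNReal.tsum_comm]
    gcongr with z
    simp only [← mul_assoc]
    rw [ENNReal.tsum_mul_right]
    gcongr
    exact ih z

lemma green_le_diag (h0 : ∀ x, q x ≠ 0) (ht : ∀ x, q x ≠ ⊤) (hq : ∀ x, ∑' z, a x z ≤ q x)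
    (x y : S) : green a q x y ≤ green a q y y := by
  refine iSup_le fun n => ?_
  induction n generalizing x with
  | zero => exact zero_le
  | succ n ih =>
    obtain rfl | h := eq_or_ne x y
    · exact le_iSup (fun n => greenIter a q n x x) (n + 1)
    refine (ENNReal.mul_le_mul_iff_right (h0 x) (ht x)).1 ?_
    calc q x * greenIter a q (n + 1) x y
        = ∑' z, a x z * greenIter a q n z y := by
          rw [greenIter_backward h0 ht, kronecker_of_ne h, zero_add]
      _ ≤ ∑' z, a x z * green a q y y := by gcongr with z; exact ih z
      _ = (∑' z, a x z) * green a q y y := ENNReal.tsum_mul_right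
      _ ≤ q x * green a q y y := by gcongr; exact hq x

lemma green_ne_top_of_path (h0 : ∀ x, q x ≠ 0) (ht : ∀ x, q x ≠ ⊤) (x : S) {y z : S}
    (hyz : Relation.ReflTransGen (fun b c => a b c ≠ 0) y z) (hz : green a q x z ≠ ⊤) :
    green a q x y ≠ ⊤ := by
  induction hyz using Relation.ReflTransGen.head_induction_on with
  | refl => exact hz
  | @head b c hbc _ ih =>
    have hle : green a q x b * a b c ≤ green a q x c * q c := by
      rw [green_forward h0 ht]
      exact (ENNReal.le_tsum (f := fun z => green a q x z * a z c) b).trans le_add_self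
    intro hb
    rw [hb, ENNReal.top_mul hbc] at hle
    exact ENNReal.mul_ne_top ih (ht c) (top_le_iff.1 hle)

end Green

section Recurrence

variable {S : Type*} {a : S → S → ℝ≥0∞} {q : S → ℝ≥0∞}

lemma superharmonic_eq_of_recurrent (h0 : ∀ x, q x ≠ 0) (ht : ∀ x, q x ≠ ⊤)
    (hrec : IsRecurrent a q) {v : S → ℝ≥0∞} (hvt : ∀ x, v x ≠ ⊤)
    (hv : ∀ x, ∑' z, a x z * v z ≤ q x * v x) (y : S) :
    ∑' z, a y z * v z = q y * v y := by
  set gap := q y * v y - ∑' z, a y z * v z with hgap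
  have hle : gap * green a q y y ≤ v y := by
    refine mul_green_le_of_superharmonic h0 ht (fun x => ?_) y
    obtain rfl | hxy := eq_or_ne x y
    · rw [kronecker_self, mul_one, hgap, tsub_add_cancel_of_le (hv x)]
    · rw [kronecker_of_ne hxy, mul_zero, zero_add]
      exact hv x
  refine le_antisymm (hv y) (tsub_eq_zero_iff_le.1 (not_not.1 fun hne => hvt y ?_))
  rwa [hrec y, ENNReal.mul_top hne, top_le_iff] at hle

lemma superinvariant_eq_of_recurrent (h0 : ∀ x, q x ≠ 0) (ht : ∀ x, q x ≠ ⊤)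
    (hrec : IsRecurrent a q) {v : S → ℝ≥0∞} (hvt : ∀ x, v x ≠ ⊤)
    (hv : ∀ y, ∑' x, v x * a x y ≤ v y * q y) (y : S) :
    ∑' x, v x * a x y = v y * q y := by
  set gap := v y * q y - ∑' x, v x * a x y with hgap
  have hle : gap * green a q y y ≤ v y := by
    have h := tsum_mul_green_le_of_superinvariant h0 ht (a := a) (v := v)
      (b := fun x => kronecker y x * gap) (fun x => ?_) y
    · simpa only [mul_assoc, tsum_kronecker_mul (fun x => gap * green a q x y)] using h
    obtain rfl | hxy := eq_or_ne y x
    · rw [kronecker_self, one_mul, hgap, tsub_add_cancel_of_le (hv y)]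
    · rw [kronecker_of_ne hxy, zero_mul, zero_add]
      exact hv x
  refine le_antisymm (hv y) (tsub_eq_zero_iff_le.1 (not_not.1 fun hne => hvt y ?_))
  rwa [hrec y, ENNReal.mul_top hne, top_le_iff] at hle

lemma invariant_ne_zero {v : S → ℝ≥0∞} (hv : ∀ y, ∑' x, v x * a x y = v y * q y) {x y : S}
    (hxy : Relation.ReflTransGen (fun b c => a b c ≠ 0) x y) (hx : v x ≠ 0) : v y ≠ 0 := by
  induction hxy with
  | refl => exact hx
  | @tail b c _ hbc ih =>
    intro hc
    have h := hv c
    rw [hc, zero_mul, ENNReal.tsum_eq_zero] at h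
    exact mul_ne_zero ih hbc (h b)

lemma eq_of_tsum_eq_of_le {f g : S → ℝ≥0∞} (hle : ∀ x, f x ≤ g x) (hg : ∑' x, g x ≠ ⊤)
    (h : ∑' x, f x = ∑' x, g x) (x : S) : f x = g x := by
  by_contra hne
  exact (ENNReal.tsum_lt_tsum (h ▸ hg) hle (lt_of_le_of_ne (hle x) hne)).ne h

lemma harmonic_eq_of_eq_at {v w : S → ℝ≥0∞} (ht : ∀ x, q x ≠ ⊤) (hat : ∀ x y, a x y ≠ ⊤)
    (hwt : ∀ x, w x ≠ ⊤) (hvw : ∀ x, v x ≤ w x) (hv : ∀ x, ∑' z, a x z * v z = q x * v x)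
    (hw : ∀ x, ∑' z, a x z * w z = q x * w x) {x y : S}
    (hxy : Relation.ReflTransGen (fun b c => a b c ≠ 0) x y) (hx : v x = w x) : v y = w y := by
  induction hxy with
  | refl => exact hx
  | @tail b c _ hbc ih =>
    have h := eq_of_tsum_eq_of_le (fun z => mul_le_mul_right (hvw z) (a b z))
      (by rw [hw]; exact ENNReal.mul_ne_top (ht b) (hwt b)) (by rw [hv, hw, ih]) c
    exact (ENNReal.mul_right_inj hbc (hat b c)).1 h

lemma invariant_eq_of_eq_at {v w : S → ℝ≥0∞} (ht : ∀ x, q x ≠ ⊤) (hat : ∀ x y, a x y ≠ ⊤)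
    (hwt : ∀ x, w x ≠ ⊤) (hvw : ∀ x, v x ≤ w x) (hv : ∀ y, ∑' x, v x * a x y = v y * q y)
    (hw : ∀ y, ∑' x, w x * a x y = w y * q y) {x y : S}
    (hxy : Relation.ReflTransGen (fun b c => a b c ≠ 0) x y) (hy : v y = w y) : v x = w x := by
  induction hxy using Relation.ReflTransGen.head_induction_on with
  | refl => exact hy
  | @head b c hbc _ ih =>
    have h := eq_of_tsum_eq_of_le (fun z => mul_le_mul_left (hvw z) (a z c))
      (by rw [hw]; exact ENNReal.mul_ne_top (hwt c) (ht c)) (by rw [hv, hw, ih]) b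
    exact (ENNReal.mul_left_inj hbc (hat b c)).1 h

/-- Subtracting from a bound turns the function into a superharmonic one, which by recurrence is
harmonic, and so constant because it attains its maximum. -/
lemma subharmonic_eq_zero_of_recurrent (h0 : ∀ x, q x ≠ 0) (ht : ∀ x, q x ≠ ⊤)
    (hat : ∀ x y, a x y ≠ ⊤) (hq : ∀ x, ∑' z, a x z = q x) (hrec : IsRecurrent a q)
    (hirr : IsIrreducibleRate a) {u : S → ℝ≥0∞} {c : ℝ≥0∞} (hc : c ≠ ⊤) (huc : ∀ x, u x ≤ c)
    (hu : ∀ x, q x * u x ≤ ∑' z, a x z * u z) {x₀ : S} (hx₀ : u x₀ = 0) (x : S) : u x = 0 := by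
  have hconst : ∀ x, ∑' z, a x z * c = q x * c := fun x => by rw [ENNReal.tsum_mul_right, hq]
  have hle : ∀ x, c - u x ≤ c := fun x => tsub_le_self
  have hsuper : ∀ x, ∑' z, a x z * (c - u z) ≤ q x * (c - u x) := fun x => by
    have hfin : ∑' z, a x z * u z ≠ ⊤ := by
      refine ne_top_of_le_ne_top (ENNReal.mul_ne_top (ht x) hc) ?_
      rw [← hconst]
      gcongr with z
      exact huc z
    refine (ENNReal.add_le_add_iff_right hfin).1 ?_
    calc ∑' z, a x z * (c - u z) + ∑' z, a x z * u z = q x * c := by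
          simp only [← ENNReal.tsum_add, ← mul_add, tsub_add_cancel_of_le (huc _), hconst]
      _ = q x * (c - u x) + q x * u x := by rw [← mul_add, tsub_add_cancel_of_le (huc x)]
      _ ≤ q x * (c - u x) + ∑' z, a x z * u z := by gcongr; exact hu x
  have hharm := superharmonic_eq_of_recurrent h0 ht hrec
    (fun x => ne_top_of_le_ne_top hc (hle x)) hsuper
  have hx : c - u x = c :=
    harmonic_eq_of_eq_at ht hat (fun _ => hc) hle hharm hconst (hirr x₀ x) (by rw [hx₀, tsub_zero])
  have hsum := tsub_add_cancel_of_le (huc x)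
  rw [hx] at hsum
  exact (ENNReal.add_right_inj hc).1 (hsum.trans (add_zero c).symm)

end Recurrence

section Killed

variable {S : Type*} {a : S → S → ℝ≥0∞} {q : S → ℝ≥0∞} {F : Set S}

/-- The jump rates of the process which is killed when it jumps to a state outside of `F`; it may
start outside of `F`. -/
noncomputable def killedRate (F : Set S) (a : S → S → ℝ≥0∞) (x : S) : S → ℝ≥0∞ :=
  F.indicator (a x)

/-- The mass of a state of `F` is accumulated during the excursions into `F`. -/
lemma tsum_mul_green_killedRate (h0 : ∀ x, q x ≠ 0) (ht : ∀ x, q x ≠ ⊤) (hat : ∀ x y, a x y ≠ ⊤)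
    (hrec : IsRecurrent a q) (hirr : IsIrreducibleRate a) {v : S → ℝ≥0∞} (hvt : ∀ x, v x ≠ ⊤)
    (hv : ∀ y, ∑' x, v x * a x y = v y * q y) {x₀ : S} (hx₀ : x₀ ∉ F) (y : S) :
    ∑' x : (Fᶜ : Set S), v x * (q x * green (killedRate F a) q x y) = v y := by
  set w : S → ℝ≥0∞ := fun y =>
    ∑' x, Fᶜ.indicator (fun x => v x * q x) x * green (killedRate F a) q x y with hw
  have hforward : ∀ y, w y * q y = Fᶜ.indicator (fun x => v x * q x) y +
      ∑' z, w z * killedRate F a z y := fun y => tsum_mul_green_forward h0 ht _ y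
  have hoff : ∀ y ∉ F, w y = v y := fun y hy => by
    have h := hforward y
    simp only [killedRate, Set.indicator_of_notMem hy, mul_zero, tsum_zero, add_zero,
      Set.indicator_of_mem (Set.mem_compl hy)] at h
    exact (ENNReal.mul_left_inj (h0 y) (ht y)).1 h
  have hle : ∀ y, w y ≤ v y := tsum_mul_green_le_of_superinvariant h0 ht fun y => by
    by_cases hy : y ∈ F
    · simp only [killedRate, Set.indicator_of_mem hy, hv, zero_add, le_refl,
        Set.indicator_of_notMem (Set.notMem_compl_iff.2 hy)]
    · simp only [killedRate, Set.indicator_of_notMem hy, mul_zero, tsum_zero, add_zero, le_refl,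
        Set.indicator_of_mem (Set.mem_compl hy)]
  have hsuper : ∀ y, ∑' x, w x * a x y ≤ w y * q y := fun y => by
    by_cases hy : y ∈ F
    · simp only [hforward, killedRate, Set.indicator_of_mem hy, zero_add, le_refl,
        Set.indicator_of_notMem (Set.notMem_compl_iff.2 hy)]
    · rw [hoff y hy, ← hv]
      gcongr with x
      exact hle x
  have hwt : ∀ y, w y ≠ ⊤ := fun y => ne_top_of_le_ne_top (hvt y) (hle y)
  have hwv : w y = v y := invariant_eq_of_eq_at ht hat hvt hle
    (superinvariant_eq_of_recurrent h0 ht hrec hwt hsuper) hv (hirr y x₀) (hoff x₀ hx₀)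
  rw [← hwv, hw, tsum_subtype (Fᶜ) fun x => v x * (q x * green (killedRate F a) q x y)]
  refine tsum_congr fun x => ?_
  by_cases hx : x ∈ Fᶜ
  · simp only [Set.indicator_of_mem hx, mul_assoc]
  · simp only [Set.indicator_of_notMem hx, zero_mul]

lemma tsum_killedRate_mul_congr {f g : S → ℝ≥0∞} (hfg : ∀ z ∈ F, f z = g z) (x : S) :
    ∑' z, killedRate F a x z * f z = ∑' z, killedRate F a x z * g z := by
  refine tsum_congr fun z => ?_
  by_cases hz : z ∈ F
  · rw [hfg z hz]
  · rw [killedRate, Set.indicator_of_notMem hz, zero_mul, zero_mul]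

lemma green_killedRate_le_of_superharmonicOn (h0 : ∀ x, q x ≠ 0) (ht : ∀ x, q x ≠ ⊤)
    {h : S → ℝ≥0∞} {y : S}
    (hh : ∀ x ∈ F, kronecker x y + ∑' z, killedRate F a x z * h z ≤ q x * h x) {x : S}
    (hx : x ∈ F) : green (killedRate F a) q x y ≤ h x := by
  classical
  have hext : ∀ z ∈ F, F.piecewise h ⊤ z = h z := fun z hz => Set.piecewise_eq_of_mem _ _ _ hz
  have hle := mul_green_le_of_superharmonic h0 ht (a := killedRate F a) (c := 1) (y := y)
    (v := F.piecewise h ⊤) (fun x => ?_) x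
  · rwa [one_mul, hext x hx] at hle
  by_cases hx : x ∈ F
  · rw [tsum_killedRate_mul_congr hext, hext x hx, one_mul]
    exact hh x hx
  · rw [Set.piecewise_eq_of_notMem _ _ _ hx, Pi.top_apply, ENNReal.mul_top (h0 x)]
    exact le_top

/-- By recurrence a bounded solution of the killed backward equation is unique: the difference of
two solutions is bounded, harmonic on `F` and zero outside of `F`. -/
lemma eq_green_killedRate (h0 : ∀ x, q x ≠ 0) (ht : ∀ x, q x ≠ ⊤) (hat : ∀ x y, a x y ≠ ⊤)
    (hq : ∀ x, ∑' z, a x z = q x) (hrec : IsRecurrent a q) (hirr : IsIrreducibleRate a)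
    {x₀ : S} (hx₀ : x₀ ∉ F) {h : S → ℝ≥0∞} {c : ℝ≥0∞} (hc : c ≠ ⊤) (hhc : ∀ x, h x ≤ c) {y : S}
    (hh : ∀ x ∈ F, q x * h x = kronecker x y + ∑' z, killedRate F a x z * h z) {x : S}
    (hx : x ∈ F) : h x = green (killedRate F a) q x y := by
  have hle : ∀ x ∈ F, green (killedRate F a) q x y ≤ h x := fun x hx =>
    green_killedRate_le_of_superharmonicOn h0 ht (fun x hx => (hh x hx).ge) hx
  set u : S → ℝ≥0∞ := F.indicator fun x => h x - green (killedRate F a) q x y with hu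
  have hadd : ∀ x ∈ F, u x + green (killedRate F a) q x y = h x := fun x hx => by
    rw [hu, Set.indicator_of_mem hx, tsub_add_cancel_of_le (hle x hx)]
  have huc : ∀ x, u x ≤ c := Set.indicator_le' (fun x _ => tsub_le_self.trans (hhc x))
    fun _ _ => zero_le
  have hsub : ∀ x, q x * u x ≤ ∑' z, a x z * u z := fun x => by
    by_cases hx : x ∈ F
    swap
    · simp only [hu, Set.indicator_of_notMem hx, mul_zero, zero_le]
    have hGt : q x * green (killedRate F a) q x y ≠ ⊤ :=
      ENNReal.mul_ne_top (ht x) (ne_top_of_le_ne_top hc ((hle x hx).trans (hhc x)))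
    refine (ENNReal.add_le_add_iff_right hGt).1 ?_
    calc q x * u x + q x * green (killedRate F a) q x y
        = kronecker x y + ∑' z, killedRate F a x z * h z := by rw [← mul_add, hadd x hx, hh x hx]
      _ = ∑' z, killedRate F a x z * u z + q x * green (killedRate F a) q x y := by
          rw [green_backward h0 ht, ← tsum_killedRate_mul_congr hadd]
          simp only [mul_add, ENNReal.tsum_add]
          rw [add_left_comm]
      _ ≤ ∑' z, a x z * u z + q x * green (killedRate F a) q x y := by
          gcongr with z
          exact Set.indicator_le_self F (a x) z
  have hux : u x = 0 := subharmonic_eq_zero_of_recurrent h0 ht hat hq hrec hirr hc huc hsub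
    (Set.indicator_of_notMem hx₀ _) x
  rw [← hadd x hx, hux, zero_add]

end Killed

section DiscountedTime

open MeasureTheory

/-- Lebesgue measure on `[0, ∞)` with density `exp (-(r * t))`. Integrating against it is taking the
Laplace transform at `r`, which for `r = 0` is the integral over `[0, ∞)`. -/
noncomputable def discountMeasure (r : ℝ) : Measure ℝ :=
  (volume.restrict (Set.Ici 0)).withDensity fun t => ENNReal.ofReal (Real.exp (-(r * t)))

lemma lintegral_discountMeasure (r : ℝ) (f : ℝ → ℝ≥0∞) :
    ∫⁻ t, f t ∂discountMeasure r =
      ∫⁻ t in Set.Ici 0, ENNReal.ofReal (Real.exp (-(r * t))) * f t :=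
  lintegral_withDensity_eq_lintegral_mul_non_measurable _ (by fun_prop)
    (Filter.Eventually.of_forall fun _ => ENNReal.ofReal_lt_top) f

lemma lintegral_discountMeasure_congr (r : ℝ) {f g : ℝ → ℝ≥0∞} (h : ∀ t, 0 ≤ t → f t = g t) :
    ∫⁻ t, f t ∂discountMeasure r = ∫⁻ t, g t ∂discountMeasure r := by
  simp only [lintegral_discountMeasure]
  exact setLIntegral_congr_fun measurableSet_Ici fun t ht => by simp only [h t ht]

lemma lintegral_exp_discountMeasure {r c : ℝ} (hcr : c ≤ r) :
    ∫⁻ t, ENNReal.ofReal (Real.exp (c * t)) ∂discountMeasure r = (ENNReal.ofReal (r - c))⁻¹ := by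
  have hexp : ∀ t, ENNReal.ofReal (Real.exp (-(r * t))) * ENNReal.ofReal (Real.exp (c * t)) =
      ENNReal.ofReal (Real.exp ((c - r) * t)) := fun t => by
    rw [← ENNReal.ofReal_mul (Real.exp_pos _).le, ← Real.exp_add]
    ring_nf
  rw [lintegral_discountMeasure, setLIntegral_congr Ioi_ae_eq_Ici.symm]
  simp only [hexp]
  obtain rfl | hlt := hcr.eq_or_lt
  · simp
  · rw [← ofReal_integral_eq_lintegral_ofReal
      (integrableOn_exp_mul_Ioi (sub_neg.2 hlt) 0)
      (Filter.Eventually.of_forall fun _ => (Real.exp_pos _).le),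
      integral_exp_mul_Ioi (sub_neg.2 hlt), ← ENNReal.ofReal_inv_of_pos (sub_pos.2 hlt),
      mul_zero, Real.exp_zero, neg_div, ← div_neg, neg_sub, one_div]

lemma lintegral_lintegral_mul_sub {f g : ℝ → ℝ≥0∞} (hf : Measurable f) (hg : Measurable g) :
    ∫⁻ t, ∫⁻ s, f s * g (t - s) = (∫⁻ s, f s) * ∫⁻ t, g t := by
  rw [lintegral_lintegral_swap (by fun_prop), ← lintegral_mul_const _ hf]
  refine lintegral_congr fun s => ?_
  rw [lintegral_const_mul _ (by fun_prop), lintegral_sub_right_eq_self g s]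

lemma lintegral_convolution_discountMeasure (r : ℝ) {f g : ℝ → ℝ≥0∞} (hf : Measurable f)
    (hg : Measurable g) :
    ∫⁻ t, (∫⁻ s in Set.Icc 0 t, f s * g (t - s)) ∂discountMeasure r =
      (∫⁻ t, f t ∂discountMeasure r) * ∫⁻ t, g t ∂discountMeasure r := by
  set weight : ℝ → ℝ≥0∞ :=
    (Set.Ici 0).indicator fun t => ENNReal.ofReal (Real.exp (-(r * t))) with hweight
  have hmeas : Measurable weight := by
    rw [hweight]
    exact Measurable.indicator (by fun_prop) measurableSet_Ici
  have hlaplace : ∀ h : ℝ → ℝ≥0∞,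
      ∫⁻ t, h t ∂discountMeasure r = ∫⁻ t, weight t * h t := fun h => by
    rw [lintegral_discountMeasure, ← lintegral_indicator measurableSet_Ici]
    simp only [hweight, ← Set.indicator_mul_left]
  have hmul : ∀ t s, (Set.Icc 0 t).indicator (fun s => weight t * (f s * g (t - s))) s =
      weight s * f s * (weight (t - s) * g (t - s)) := fun t s => by
    by_cases hs : 0 ≤ s <;> by_cases hst : s ≤ t <;>
      simp only [hweight, Set.indicator_apply, Set.mem_Icc, Set.mem_Ici, sub_nonneg, hs, hst,
        if_true, if_false, and_true, and_false, zero_mul, mul_zero]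
    rw [if_pos (hs.trans hst)]
    have hexp : ENNReal.ofReal (Real.exp (-(r * t))) = ENNReal.ofReal (Real.exp (-(r * s))) *
        ENNReal.ofReal (Real.exp (-(r * (t - s)))) := by
      rw [← ENNReal.ofReal_mul (Real.exp_pos _).le, ← Real.exp_add]
      ring_nf
    rw [hexp]
    ring
  simp only [hlaplace]
  rw [← lintegral_lintegral_mul_sub (by fun_prop) (by fun_prop)]
  refine lintegral_congr fun t => ?_
  rw [← lintegral_const_mul _ (by fun_prop), ← lintegral_indicator measurableSet_Icc]
  exact lintegral_congr fun s => hmul t s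

end DiscountedTime

section MinimalProcess

open MeasureTheory

variable {S : Type} {Q : S → S → ℝ}

open Classical in
/-- The off-diagonal rates of a `q`-matrix, as jump rates; the diagonal is replaced by `0`. -/
noncomputable def offRate (Q : S → S → ℝ) (x z : S) : ℝ≥0∞ :=
  ENNReal.ofReal (Function.update (Q x) x 0 z)

/-- The total rate at which a state is left. -/
noncomputable def exitRate (Q : S → S → ℝ) (x : S) : ℝ≥0∞ := ENNReal.ofReal (-(Q x x))

lemma exitRate_ne_top (x : S) : exitRate Q x ≠ ⊤ := ENNReal.ofReal_ne_top

lemma offRate_ne_top (x z : S) : offRate Q x z ≠ ⊤ := ENNReal.ofReal_ne_top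

lemma offRate_self (x : S) : offRate Q x x = 0 := by
  classical rw [offRate, Function.update_self, ENNReal.ofReal_zero]

lemma offRate_of_ne {x z : S} (h : x ≠ z) : offRate Q x z = ENNReal.ofReal (Q x z) := by
  classical rw [offRate, Function.update_of_ne h.symm]

lemma isIrreducibleRate_offRate (hirr : IsIrreducibleQMatrix Q) :
    IsIrreducibleRate (offRate Q) := fun x y =>
  Relation.ReflTransGen.mono (fun b c h => by
    rw [offRate_of_ne h.1]
    exact (ENNReal.ofReal_pos.2 h.2).ne') x y (hirr x y)

lemma transitionIter_succ (n : ℕ) (t : ℝ) (x y : S) : transitionIter Q (n + 1) t x y =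
    kronecker x y * ENNReal.ofReal (Real.exp (Q x x * t)) +
      ∫⁻ s in Set.Icc 0 t, ENNReal.ofReal (Real.exp (Q x x * s)) *
        ∑' z, offRate Q x z * transitionIter Q n (t - s) z y := by
  classical
  have hoff : ∀ z, (if z = x then 0 else ENNReal.ofReal (Q x z)) = offRate Q x z := fun z => by
    split_ifs with hz
    · rw [hz, offRate_self]
    · rw [offRate_of_ne (Ne.symm hz)]
  simp only [transitionIter, kronecker, ite_mul, one_mul, zero_mul, ← hoff]

lemma transitionIter_le_succ (n : ℕ) (t : ℝ) (x y : S) :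
    transitionIter Q n t x y ≤ transitionIter Q (n + 1) t x y := by
  induction n generalizing t x with
  | zero => exact zero_le
  | succ n ih =>
    rw [transitionIter_succ, transitionIter_succ (n + 1)]
    gcongr with s z
    exact ih _ z

lemma transitionIter_mono (t : ℝ) (x y : S) : Monotone fun n => transitionIter Q n t x y :=
  monotone_nat_of_le_succ fun n => transitionIter_le_succ n t x y

lemma measurable_transitionIter [Countable S] (n : ℕ) (x y : S) :
    Measurable fun t => transitionIter Q n t x y := by
  induction n generalizing x with
  | zero => exact measurable_const
  | succ n ih =>
    simp only [transitionIter_succ]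
    refine Measurable.add (by fun_prop) ?_
    have hindicator : ∀ t, ∫⁻ s in Set.Icc 0 t, ENNReal.ofReal (Real.exp (Q x x * s)) *
        ∑' z, offRate Q x z * transitionIter Q n (t - s) z y =
        ∫⁻ s, {p : ℝ × ℝ | p.2 ∈ Set.Icc 0 p.1}.indicator (fun p =>
          ENNReal.ofReal (Real.exp (Q x x * p.2)) *
            ∑' z, offRate Q x z * transitionIter Q n (p.1 - p.2) z y) (t, s) := fun t => by
      rw [← lintegral_indicator measurableSet_Icc]
      rfl
    simp only [hindicator]
    refine Measurable.lintegral_prod_right' (Measurable.indicator ?_ ?_)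
    · fun_prop
    · exact (measurableSet_le measurable_const measurable_snd).inter
        (measurableSet_le measurable_snd measurable_fst)

lemma measurable_minimalTransition [Countable S] (x y : S) :
    Measurable fun t => minimalTransition Q t x y :=
  Measurable.iSup fun n => measurable_transitionIter n x y

lemma lintegral_transitionIter [Countable S] (hd : ∀ x, Q x x ≤ 0) {r : ℝ} (hr : 0 ≤ r) (n : ℕ)
    (x y : S) : ∫⁻ t, transitionIter Q n t x y ∂discountMeasure r =
      greenIter (offRate Q) (fun x => exitRate Q x + ENNReal.ofReal r) n x y := by
  induction n generalizing x with
  | zero => simp only [transitionIter, greenIter, lintegral_zero]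
  | succ n ih =>
    have hmeas : ∀ z, Measurable fun t => transitionIter Q n t z y := fun z =>
      measurable_transitionIter n z y
    have hholding : ∫⁻ t, ENNReal.ofReal (Real.exp (Q x x * t)) ∂discountMeasure r =
        (exitRate Q x + ENNReal.ofReal r)⁻¹ := by
      rw [lintegral_exp_discountMeasure ((hd x).trans hr), exitRate,
        ← ENNReal.ofReal_add (neg_nonneg.2 (hd x)) hr, sub_eq_neg_add]
    simp only [transitionIter_succ]
    rw [lintegral_add_left (by fun_prop), lintegral_const_mul _ (by fun_prop),
      lintegral_convolution_discountMeasure r (f := fun s => ENNReal.ofReal (Real.exp (Q x x * s)))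
        (g := fun t => ∑' z, offRate Q x z * transitionIter Q n t z y) (by fun_prop) (by fun_prop),
      hholding,
      lintegral_tsum fun z => ((hmeas z).const_mul _).aemeasurable, greenIter, add_mul]
    simp only [lintegral_const_mul _ (hmeas _), ih]
    rw [mul_comm _ (tsum _)]

lemma lintegral_minimalTransition [Countable S] (hd : ∀ x, Q x x ≤ 0) {r : ℝ} (hr : 0 ≤ r)
    (x y : S) : ∫⁻ t, minimalTransition Q t x y ∂discountMeasure r =
      green (offRate Q) (fun x => exitRate Q x + ENNReal.ofReal r) x y := by
  simp only [minimalTransition, green, ← lintegral_transitionIter hd hr]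
  exact lintegral_iSup (fun n => measurable_transitionIter n x y)
    fun m n hmn t => transitionIter_mono t x y hmn

lemma meanSojourn_eq_green [Countable S] (hd : ∀ x, Q x x ≤ 0) (x y : S) :
    meanSojourn Q x y = green (offRate Q) (exitRate Q) x y := by
  have h := lintegral_minimalTransition hd le_rfl x y
  simp only [lintegral_discountMeasure, neg_zero, zero_mul, Real.exp_zero, ENNReal.ofReal_one,
    one_mul, ENNReal.ofReal_zero, add_zero] at h
  rw [meanSojourn, setLIntegral_congr Ioi_ae_eq_Ici, h]

lemma tsum_mul_resolvent [Countable S] (hd : ∀ x, Q x x ≤ 0) {v : S → ℝ≥0∞}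
    (hv : ∀ t, 0 ≤ t → ∀ y, ∑' x, v x * minimalTransition Q t x y = v y) {r : ℝ} (hr : 0 ≤ r)
    (y : S) :
    ∑' x, v x * green (offRate Q) (fun x => exitRate Q x + ENNReal.ofReal r) x y =
      v y * (ENNReal.ofReal r)⁻¹ := by
  have hmeas : ∀ x, Measurable fun t => minimalTransition Q t x y := fun x =>
    measurable_minimalTransition x y
  have htotal : ∫⁻ _, 1 ∂discountMeasure r = (ENNReal.ofReal r)⁻¹ := by
    simpa using lintegral_exp_discountMeasure hr
  simp only [← lintegral_minimalTransition hd hr, ← lintegral_const_mul _ (hmeas _)]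
  rw [← lintegral_tsum fun x => ((hmeas x).const_mul _).aemeasurable,
    lintegral_discountMeasure_congr r fun t ht => hv t ht y, ← htotal,
    ← lintegral_const_mul _ measurable_const]
  simp only [mul_one]

lemma tsum_mul_offRate_of_invariant [Countable S] (hd : ∀ x, Q x x ≤ 0) {v : S → ℝ≥0∞}
    (hvt : ∀ x, v x ≠ ⊤) (hv : ∀ t, 0 ≤ t → ∀ y, ∑' x, v x * minimalTransition Q t x y = v y)
    (y : S) : ∑' x, v x * offRate Q x y = v y * exitRate Q y := by
  have h := tsum_mul_green_forward (a := offRate Q)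
    (q := fun x => exitRate Q x + ENNReal.ofReal 1) (fun x => by simp)
    (fun x => by simp [exitRate_ne_top]) v y
  simp only [tsum_mul_resolvent hd hv zero_le_one] at h
  simp only [ENNReal.ofReal_one, inv_one, mul_one, mul_add] at h
  rw [add_comm] at h
  exact ((ENNReal.add_right_inj (hvt y)).1 h).symm

lemma green_diag_eq_top_of_invariant [Countable S] (hd : ∀ x, Q x x ≤ 0)
    (h0 : ∀ x, exitRate Q x ≠ 0) (hq : ∀ x, ∑' z, offRate Q x z ≤ exitRate Q x) {v : S → ℝ≥0∞}
    (hvt : ∑' x, v x ≠ ⊤) (hv : ∀ t, 0 ≤ t → ∀ y, ∑' x, v x * minimalTransition Q t x y = v y)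
    {y : S} (hy : v y ≠ 0) : green (offRate Q) (exitRate Q) y y = ⊤ := by
  have h := tsum_mul_resolvent hd hv le_rfl y
  simp only [ENNReal.ofReal_zero, add_zero, ENNReal.inv_zero, ENNReal.mul_top hy] at h
  have hle : ⊤ ≤ (∑' x, v x) * green (offRate Q) (exitRate Q) y y := by
    rw [← h, ← ENNReal.tsum_mul_right]
    gcongr with x
    exact green_le_diag h0 exitRate_ne_top hq x y
  by_contra hne
  exact ENNReal.mul_ne_top hvt hne (top_le_iff.1 hle)

end MinimalProcess

section RowSums

variable {S : Type} {Q : S → S → ℝ} {x : S} {k : ℝ}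

open Classical in
lemma hasSum_update_diag (h : HasSum (Q x) (-k)) :
    HasSum (Function.update (Q x) x 0) (-(Q x x) - k) := by
  have h' := h.update x 0
  rwa [zero_sub, ← sub_eq_add_neg] at h'

open Classical in
lemma update_diag_nonneg (hoff : ∀ y, x ≠ y → 0 ≤ Q x y) (z : S) :
    0 ≤ Function.update (Q x) x 0 z := by
  obtain rfl | hz := eq_or_ne x z
  · rw [Function.update_self]
  · rw [Function.update_of_ne hz.symm]
    exact hoff z hz

lemma diag_le_of_hasSum (hoff : ∀ y, x ≠ y → 0 ≤ Q x y) (h : HasSum (Q x) (-k)) :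
    Q x x ≤ -k := by
  linarith [(hasSum_update_diag h).nonneg (update_diag_nonneg hoff)]

lemma tsum_offRate_add (hoff : ∀ y, x ≠ y → 0 ≤ Q x y) (hk : 0 ≤ k) (h : HasSum (Q x) (-k)) :
    ∑' z, offRate Q x z + ENNReal.ofReal k = exitRate Q x := by
  have hsum := hasSum_update_diag h
  have hnonneg := update_diag_nonneg hoff
  simp only [offRate, exitRate]
  rw [← ENNReal.ofReal_tsum_of_nonneg hnonneg hsum.summable, hsum.tsum_eq,
    ← ENNReal.ofReal_add (hsum.nonneg hnonneg) hk, sub_add_cancel]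

namespace IsConservativeQMatrix

variable (hQ : IsConservativeQMatrix Q) (x)
include hQ

lemma diag_nonpos : Q x x ≤ 0 := by
  have h := diag_le_of_hasSum (hQ.1 x) (k := 0) (by simpa only [neg_zero] using hQ.2 x)
  rwa [neg_zero] at h

lemma tsum_offRate : ∑' z, offRate Q x z = exitRate Q x := by
  simpa only [ENNReal.ofReal_zero, add_zero] using
    tsum_offRate_add (hQ.1 x) le_rfl (by simpa only [neg_zero] using hQ.2 x)

lemma exitRate_ne_zero [Nontrivial S] (hirr : IsIrreducibleQMatrix Q) : exitRate Q x ≠ 0 := by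
  intro h
  obtain ⟨y, hyx⟩ := exists_ne x
  rw [← hQ.tsum_offRate, ENNReal.tsum_eq_zero] at h
  obtain heq | ⟨z, hxz, -⟩ := (isIrreducibleRate_offRate hirr x y).cases_head
  · exact hyx heq.symm
  · exact hxz (h z)

end IsConservativeQMatrix

lemma IsStationaryDistribution.meanSojourn_diag_eq_top [Countable S] [Nontrivial S]
    (hQ : IsConservativeQMatrix Q) (hirr : IsIrreducibleQMatrix Q) {p : S → ℝ}
    (hp : IsStationaryDistribution Q p) (y : S) : meanSojourn Q y y = ⊤ := by
  obtain ⟨hp0, hp1, hpt⟩ := hp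
  have htotal : ∑' x, ENNReal.ofReal (p x) = 1 := by
    rw [← ENNReal.ofReal_tsum_of_nonneg hp0 hp1.summable, hp1.tsum_eq, ENNReal.ofReal_one]
  obtain ⟨x, hx⟩ : ∃ x, ENNReal.ofReal (p x) ≠ 0 := by
    by_contra! h
    exact zero_ne_one ((ENNReal.tsum_eq_zero.2 h).symm.trans htotal)
  have hy : ENNReal.ofReal (p y) ≠ 0 :=
    invariant_ne_zero (v := fun x => ENNReal.ofReal (p x))
      (tsum_mul_offRate_of_invariant hQ.diag_nonpos (fun _ => ENNReal.ofReal_ne_top) hpt)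
      (isIrreducibleRate_offRate hirr x y) hx
  rw [meanSojourn_eq_green hQ.diag_nonpos]
  exact green_diag_eq_top_of_invariant hQ.diag_nonpos (fun x => hQ.exitRate_ne_zero x hirr)
    (fun x => (hQ.tsum_offRate x).le) (htotal.trans_ne ENNReal.one_ne_top) hpt hy

end RowSums

section MatrixInverse

variable {S : Type} {Q : S → S → ℝ}

lemma hasSum_mul_neg_toReal {x y : S} (hd : Q x x ≤ 0) (hoff : ∀ z, x ≠ z → 0 ≤ Q x z)
    {T : S → ℝ≥0∞} (hT : ∀ z, T z ≠ ⊤)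
    (h : exitRate Q x * T x = kronecker x y + ∑' z, offRate Q x z * T z) :
    HasSum (fun z => Q x z * -(T z).toReal) (kronecker x y).toReal := by
  have hne : ∑' z, offRate Q x z * T z ≠ ⊤ := by
    refine ne_top_of_le_ne_top (ENNReal.mul_ne_top (exitRate_ne_top (Q := Q) x) (hT x)) ?_
    rw [h]
    exact le_add_self
  have hreal : -(Q x x) * (T x).toReal =
      (kronecker x y).toReal + ∑' z, (offRate Q x z * T z).toReal := by
    rw [← ENNReal.tsum_toReal_eq (ENNReal.ne_top_of_tsum_ne_top hne),
      ← ENNReal.toReal_add (kronecker_ne_top x y) hne, ← h, ENNReal.toReal_mul, exitRate,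
      ENNReal.toReal_ofReal (neg_nonneg.2 hd)]
  classical
  have hsum := (hasSum_ite_eq x (-(Q x x) * (T x).toReal)).sub
    (ENNReal.summable_toReal hne).hasSum
  rw [hreal, add_sub_cancel_right] at hsum
  refine hsum.congr_fun fun z => ?_
  obtain rfl | hz := eq_or_ne x z
  · rw [offRate_self, if_pos rfl, ← hreal, zero_mul, ENNReal.toReal_zero, sub_zero]
    ring
  · rw [offRate_of_ne hz, if_neg hz.symm, ENNReal.toReal_mul, ENNReal.toReal_ofReal (hoff z hz)]
    ring

lemma isMatrixInverse_qInverse [Countable S] (hd : ∀ x, Q x x ≤ 0)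
    (hoff : ∀ x y, x ≠ y → 0 ≤ Q x y) (h0 : ∀ x, exitRate Q x ≠ 0)
    (hfin : ∀ x y, meanSojourn Q x y ≠ ⊤) : IsMatrixInverse Q (qInverse Q) := by
  simp only [meanSojourn_eq_green hd] at hfin
  simp only [IsMatrixInverse, qInverse, meanSojourn_eq_green hd, ← toReal_kronecker]
  refine ⟨fun i j => hasSum_mul_neg_toReal (hd i) (hoff i) (fun z => hfin z j)
    (green_backward h0 exitRate_ne_top i j), fun i j => ?_⟩
  have htranspose : ∀ z, offRate (fun a b => Q b a) j z = offRate Q z j := fun z => by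
    obtain rfl | hz := eq_or_ne j z
    · rw [offRate_self, offRate_self]
    · rw [offRate_of_ne hz, offRate_of_ne hz.symm]
  have hforward : exitRate (fun a b => Q b a) j * green (offRate Q) (exitRate Q) i j =
      kronecker j i +
        ∑' z, offRate (fun a b => Q b a) j z * green (offRate Q) (exitRate Q) i z := by
    rw [mul_comm, kronecker_comm]
    simp only [htranspose, mul_comm (offRate Q _ j)]
    exact green_forward h0 exitRate_ne_top i j
  have h := hasSum_mul_neg_toReal (Q := fun a b => Q b a) (hd j) (fun z hz => hoff z j hz.symm)
    (hfin i) hforward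
  rw [kronecker_comm] at h
  exact h.congr_fun fun z => mul_comm _ _

open Classical in
lemma IsMatrixInverse.eq_of_finite [Finite S] {A N N' : S → S → ℝ} (h : IsMatrixInverse A N)
    (h' : IsMatrixInverse A N') : N = N' := by
  have := Fintype.ofFinite S
  have hleft : Matrix.of N * Matrix.of A = 1 := by
    ext i j
    rw [Matrix.mul_apply, Matrix.one_apply]
    exact (hasSum_fintype _).unique (h.2 i j)
  have hright : Matrix.of A * Matrix.of N' = 1 := by
    ext i j
    rw [Matrix.mul_apply, Matrix.one_apply]
    exact (hasSum_fintype _).unique (h'.1 i j)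
  exact Matrix.of.injective (left_inv_eq_right_inv hleft hright)

end MatrixInverse

lemma finite_phase {ℓ : ℕ∞} (hℓ : ℓ ≠ ⊤) : Finite (Phase ℓ) := by
  obtain ⟨n, rfl⟩ := ENat.ne_top_iff_exists.1 hℓ
  exact (Set.finite_Iic n).subset fun i (hi : (i : ℕ∞) ≤ n) => by exact_mod_cast hi

namespace QSFBlocks

variable {ℓ : ℕ∞} {B : QSFBlocks ℓ}

instance : Nontrivial (QSFState ℓ) :=
  ⟨(⟨-1, by lia⟩, Phase.zero ℓ), (⟨0, le_rfl⟩, Phase.zero ℓ), by simp⟩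

section Generator

variable {x y : QSFState ℓ}

lemma generator_far (h : y.1.1 < x.1.1 - 1) : B.generator x y = 0 := if_pos h

lemma generator_down (h : y.1.1 = x.1.1 - 1) : B.generator x y = B.D x.2 y.2 := by
  rw [generator, if_neg (by lia), if_pos h]

lemma generator_same (h : y.1.1 = x.1.1) (h0 : x.1.1 < 0) : B.generator x y = B.W x.2 y.2 := by
  rw [generator, if_neg (by lia), if_neg (by lia), if_neg (by lia), if_pos h]

lemma generator_up (h : x.1.1 < y.1.1) (h0 : y.1.1 < 0) :
    B.generator x y = B.U (y.1.1 - x.1.1).toNat x.2 y.2 := by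
  rw [generator, if_neg (by lia), if_neg (by lia), if_neg (by lia), if_neg (by lia)]

lemma ne_of_level_ne (h : x.1.1 ≠ y.1.1) : x ≠ y := fun hxy => h (by rw [hxy])

section Blocks

variable (hcons : IsConservativeQMatrix B.generator)
include hcons

lemma summable_generator_level (x : QSFState ℓ) (l : {m : ℤ // m ≤ 0}) :
    Summable fun r => B.generator x (l, r) :=
  (hcons.2 x).summable.comp_injective (Prod.mk_right_injective l)

lemma summable_D (i : Phase ℓ) : Summable (B.D i) :=
  (summable_generator_level hcons (⟨-1, by lia⟩, i) ⟨-2, by lia⟩).congr fun _ =>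
    generator_down (by norm_num)

lemma summable_W (i : Phase ℓ) : Summable (B.W i) :=
  (summable_generator_level hcons (⟨-1, by lia⟩, i) ⟨-1, by lia⟩).congr fun _ =>
    generator_same rfl (by norm_num)

lemma D_nonneg (i j : Phase ℓ) : 0 ≤ B.D i j := by
  rw [← generator_down (x := (⟨-1, by lia⟩, i)) (y := (⟨-2, by lia⟩, j)) (by norm_num)]
  exact hcons.1 _ _ (ne_of_level_ne (by norm_num))

lemma W_nonneg {i j : Phase ℓ} (hij : i ≠ j) : 0 ≤ B.W i j := by
  rw [← generator_same (x := (⟨-1, by lia⟩, i)) (y := (⟨-1, by lia⟩, j)) rfl (by norm_num)]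
  exact hcons.1 _ _ fun h => hij (congrArg Prod.snd h)

lemma U_nonneg {s : ℕ} (hs : 1 ≤ s) (i j : Phase ℓ) : 0 ≤ B.U s i j := by
  have h := generator_up (B := B) (x := (⟨-1 - s, by lia⟩, i)) (y := (⟨-1, by lia⟩, j))
    (by dsimp only; lia) (by norm_num)
  rw [show ((-1 : ℤ) - (-1 - s)).toNat = s by lia] at h
  rw [← h]
  exact hcons.1 _ _ (ne_of_level_ne (by dsimp only; lia))

end Blocks

end Generator

section Levels

lemma indicator_superLevel {M : Type*} [AddZeroClass M] {m : ℤ} (hm : m ≤ 0)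
    (f : QSFState ℓ → M) (z : QSFState ℓ) : (superLevel ℓ m).indicator f z =
      (Set.range (Prod.mk ⟨m, hm⟩)).indicator f z + (superLevel ℓ (m + 1)).indicator f z := by
  have hunion : superLevel ℓ m = Set.range (Prod.mk ⟨m, hm⟩) ∪ superLevel ℓ (m + 1) := by
    ext ⟨⟨k, hk⟩, i⟩
    simp only [superLevel, Set.mem_ofPred_eq, Set.mem_union, Set.mem_range, Prod.mk.injEq,
      Subtype.mk.injEq, exists_eq_right]
    lia
  have hdisjoint : Disjoint (Set.range (Prod.mk ⟨m, hm⟩)) (superLevel ℓ (m + 1)) := by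
    rw [Set.disjoint_left]
    rintro _ ⟨i, rfl⟩
    simp only [superLevel, Set.mem_ofPred_eq]
    lia
  rw [hunion, Set.indicator_union_of_disjoint hdisjoint]

lemma hasSum_indicator_superLevel_succ {f : QSFState ℓ → ℝ} {m : ℤ} (hm : m ≤ 0) {s t : ℝ}
    (hs : HasSum ((superLevel ℓ m).indicator f) s) (ht : HasSum (fun r => f (⟨m, hm⟩, r)) t) :
    HasSum ((superLevel ℓ (m + 1)).indicator f) (s - t) := by
  have hlevel : HasSum ((Set.range (Prod.mk ⟨m, hm⟩)).indicator f) t :=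
    hasSum_subtype_iff_indicator.1 ((Prod.mk_right_injective _).hasSum_range_iff.2 ht)
  refine (hs.sub hlevel).congr_fun fun z => ?_
  rw [indicator_superLevel hm, add_sub_cancel_left]

lemma tsum_indicator_superLevel (f : QSFState ℓ → ℝ≥0∞) {m : ℤ} (hm : m ≤ 0) :
    ∑' z, (superLevel ℓ m).indicator f z =
      ∑' r, f (⟨m, hm⟩, r) + ∑' z, (superLevel ℓ (m + 1)).indicator f z := by
  rw [tsum_congr (indicator_superLevel hm f), ENNReal.tsum_add, ← tsum_subtype (Set.range _) f,
    tsum_range f (Prod.mk_right_injective _)]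

lemma generator_eq_zero_of_notMem_superLevel {m : ℤ} {x z : QSFState ℓ} (hx : m < x.1.1)
    (hz : z ∉ superLevel ℓ m) : B.generator x z = 0 := by
  simp only [superLevel, Set.mem_ofPred_eq, not_le] at hz
  exact generator_far (by lia)

end Levels

section UpwardJumps

variable (B) in
/-- The total rate of the jumps from phase `i` of a low level up by at least `n` levels. -/
noncomputable def upRate (n : ℕ) (i : Phase ℓ) : ℝ := ∑' s : ℕ, ∑' r, B.U (n + s) i r

lemma upRate_nonneg (hcons : IsConservativeQMatrix B.generator) {n : ℕ} (hn : 1 ≤ n)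
    (i : Phase ℓ) : 0 ≤ B.upRate n i :=
  tsum_nonneg fun _ => tsum_nonneg fun r => U_nonneg hcons (by lia) i r

lemma upRate_one (hhom : B.HomogeneousConservative) (i : Phase ℓ) :
    B.upRate 1 i = -((∑' r, B.D i r) + ∑' r, B.W i r) := by
  rw [← (hhom i).tsum_eq, upRate]
  simp only [add_comm 1]

lemma upRate_succ (hhom : B.HomogeneousConservative) (n : ℕ) (i : Phase ℓ) :
    B.upRate (n + 1) i = ∑' r, B.U (n + 1) i r + B.upRate (n + 2) i := by
  have hsum : Summable fun s : ℕ => ∑' r, B.U (n + 1 + s) i r := by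
    refine ((summable_nat_add_iff n).2 (hhom i).summable).congr fun s => ?_
    rw [show s + n + 1 = n + 1 + s by ring]
  rw [upRate, hsum.tsum_eq_zero_add, add_zero, upRate]
  simp only [show ∀ s, n + 1 + (s + 1) = n + 2 + s by lia]

lemma hasSum_generator_superLevel_succ_self (hcons : IsConservativeQMatrix B.generator)
    (hhom : B.HomogeneousConservative) (x : QSFState ℓ) (hx : x.1.1 < 0) :
    HasSum ((superLevel ℓ (x.1.1 + 1)).indicator (B.generator x)) (B.upRate 1 x.2) := by
  have hall : HasSum ((superLevel ℓ (x.1.1 - 1)).indicator (B.generator x)) 0 := by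
    rw [Set.indicator_eq_self.2]
    · exact hcons.2 x
    · exact fun z hz => by_contra fun hz' =>
        hz (generator_eq_zero_of_notMem_superLevel (by lia) hz')
  have hdown : HasSum (fun r => B.generator x (⟨x.1.1 - 1, by lia⟩, r)) (∑' r, B.D x.2 r) :=
    (summable_D hcons x.2).hasSum.congr_fun fun r => generator_down rfl
  have hsame : HasSum (fun r => B.generator x (⟨x.1.1, x.1.2⟩, r)) (∑' r, B.W x.2 r) :=
    (summable_W hcons x.2).hasSum.congr_fun fun r => generator_same rfl hx
  have hgeq := hasSum_indicator_superLevel_succ _ hall hdown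
  rw [sub_add_cancel] at hgeq
  have hgt := hasSum_indicator_superLevel_succ _ hgeq hsame
  rwa [zero_sub, ← neg_add', ← upRate_one hhom] at hgt

lemma hasSum_generator_superLevel (hcons : IsConservativeQMatrix B.generator)
    (hhom : B.HomogeneousConservative) (x : QSFState ℓ) (n : ℕ) (hn : x.1.1 + n < 0) :
    HasSum ((superLevel ℓ (x.1.1 + n + 1)).indicator (B.generator x)) (B.upRate (n + 1) x.2) := by
  induction n with
  | zero =>
    simp only [Nat.cast_zero, add_zero, zero_add] at hn ⊢
    exact hasSum_generator_superLevel_succ_self hcons hhom x hn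
  | succ n ih =>
    push_cast at hn ⊢
    rw [← add_assoc]
    have hlevel : HasSum (fun r => B.generator x (⟨x.1.1 + n + 1, by lia⟩, r))
        (∑' r, B.U (n + 1) x.2 r) := by
      have hup : ∀ r, B.generator x (⟨x.1.1 + n + 1, by lia⟩, r) = B.U (n + 1) x.2 r := fun r => by
        rw [generator_up (by dsimp only; lia) (by dsimp only; lia),
          show (x.1.1 + n + 1 - x.1.1).toNat = n + 1 by lia]
      simp only [← hup]
      exact (summable_generator_level hcons x _).hasSum
    have h := hasSum_indicator_superLevel_succ _ (ih (by lia)) hlevel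
    rwa [upRate_succ hhom, add_sub_cancel_left] at h

end UpwardJumps

section Flow

variable {m : ℤ} {x : QSFState ℓ}

variable (B) in
/-- The total rate of the jumps from `x` to states of level at least `m`. -/
noncomputable def aboveRate (m : ℤ) (x : QSFState ℓ) : ℝ≥0∞ :=
  ∑' z, killedRate (superLevel ℓ m) (offRate B.generator) x z

lemma tsum_killedRate_superLevel_mul (hm : m ≤ 0) (x : QSFState ℓ) (T : Phase ℓ → ℝ≥0∞)
    (c : ℝ≥0∞) :
    ∑' z, killedRate (superLevel ℓ m) (offRate B.generator) x z *
        (if z.1.1 = m then T z.2 else c) =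
      ∑' i, offRate B.generator x (⟨m, hm⟩, i) * T i + B.aboveRate (m + 1) x * c := by
  refine (tsum_congr fun _ => Set.indicator_mul_left (superLevel ℓ m)
    (offRate B.generator x) (fun z => if z.1.1 = m then T z.2 else c)).symm.trans ?_
  rw [tsum_indicator_superLevel _ hm, aboveRate, ← ENNReal.tsum_mul_right]
  simp only [if_true, killedRate]
  congr 1
  refine tsum_congr fun z => ?_
  rw [← Set.indicator_mul_left _ _ fun _ => c]
  refine congrFun (Set.indicator_congr fun z hz => ?_) z
  simp only [superLevel, Set.mem_ofPred_eq] at hz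
  rw [if_neg (by lia)]

lemma aboveRate_of_le (hcons : IsConservativeQMatrix B.generator)
    (hhom : B.HomogeneousConservative) (hm : m < 0) (hx : x.1.1 ≤ m) :
    B.aboveRate (m + 1) x = ENNReal.ofReal (B.upRate (m + 1 - x.1.1).toNat x.2) := by
  obtain ⟨n, rfl⟩ : ∃ n : ℕ, m = x.1.1 + n := ⟨(m - x.1.1).toNat, by lia⟩
  have h := hasSum_generator_superLevel hcons hhom x n hm
  have hne : ∀ z ∈ superLevel ℓ (x.1.1 + n + 1), x ≠ z := fun z hz => by
    simp only [superLevel, Set.mem_ofPred_eq] at hz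
    exact ne_of_level_ne (by lia)
  rw [show (x.1.1 + n + 1 - x.1.1).toNat = n + 1 by lia, ← h.tsum_eq,
    ENNReal.ofReal_tsum_of_nonneg (Set.indicator_nonneg fun z hz => hcons.1 x z (hne z hz))
    h.summable]
  refine tsum_congr fun z => ?_
  by_cases hz : z ∈ superLevel ℓ (x.1.1 + n + 1)
  · rw [killedRate, Set.indicator_of_mem hz, Set.indicator_of_mem hz, offRate_of_ne (hne z hz)]
  · rw [killedRate, Set.indicator_of_notMem hz, Set.indicator_of_notMem hz, ENNReal.ofReal_zero]

variable (B) in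
/-- A level is left downwards from phase `0`, and from no other phase. -/
def ExitsFromPhaseZero : Prop :=
  (∀ i ≠ Phase.zero ℓ, ∀ j, B.D i j = 0) ∧ 0 < ∑' v, B.D (Phase.zero ℓ) v

lemma tsum_generator_compl_superLevel (i : Phase ℓ) :
    ∑' z : ((superLevel ℓ 0)ᶜ : Set (QSFState ℓ)), B.generator (⟨0, le_rfl⟩, i) z =
      ∑' j, B.D i j := by
  let below (j : Phase ℓ) : ((superLevel ℓ 0)ᶜ : Set (QSFState ℓ)) :=
    ⟨(⟨-1, by lia⟩, j), by simp only [superLevel, Set.mem_compl_iff, Set.mem_ofPred_eq]; lia⟩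
  have hinj : Function.Injective below := fun j k h => congrArg (fun z => z.1.2) h
  have hsupport : Function.support
      (fun z : ((superLevel ℓ 0)ᶜ : Set (QSFState ℓ)) => B.generator (⟨0, le_rfl⟩, i) z) ⊆
      Set.range below := by
    rintro ⟨⟨⟨k, hk⟩, j⟩, hz⟩ hne
    simp only [superLevel, Set.mem_compl_iff, Set.mem_ofPred_eq, not_le] at hz
    obtain h | rfl := lt_or_eq_of_le (show k ≤ -1 by lia)
    · exact absurd (generator_far (by dsimp only; lia)) hne
    · exact ⟨j, rfl⟩
  rw [← hinj.tsum_eq hsupport]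
  exact tsum_congr fun j => generator_down (by norm_num)

lemma exitsFromPhaseZero (hcons : IsConservativeQMatrix B.generator)
    (hexit : IsExitState B.generator (superLevel ℓ 0) (⟨0, le_rfl⟩, Phase.zero ℓ)) :
    B.ExitsFromPhaseZero := by
  obtain ⟨-, hother, hzero⟩ := hexit
  simp only [tsum_generator_compl_superLevel] at hzero
  refine ⟨fun i hi j => ?_, hzero⟩
  have hrow := hother (⟨0, le_rfl⟩, i) (by simp only [superLevel, Set.mem_ofPred_eq, le_refl])
    fun h => hi (congrArg Prod.snd h)
  rw [tsum_generator_compl_superLevel] at hrow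
  exact congrFun ((hasSum_zero_iff_of_nonneg (D_nonneg hcons i)).1
    (hrow ▸ (summable_D hcons i).hasSum)) j

lemma entrance_nonneg (hcons : IsConservativeQMatrix B.generator) (j : Phase ℓ) :
    0 ≤ B.entrance j :=
  div_nonneg (D_nonneg hcons _ _) (tsum_nonneg fun _ => D_nonneg hcons _ _)

lemma tsum_mul_entrance (hexit : B.ExitsFromPhaseZero) (j : Phase ℓ) :
    (∑' v, B.D (Phase.zero ℓ) v) * B.entrance j = B.D (Phase.zero ℓ) j :=
  mul_div_cancel₀ _ hexit.2.ne'

lemma hasSum_entrance (hcons : IsConservativeQMatrix B.generator) (hexit : B.ExitsFromPhaseZero) :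
    HasSum B.entrance 1 := by
  have h := (summable_D hcons (Phase.zero ℓ)).hasSum.div_const (∑' v, B.D (Phase.zero ℓ) v)
  rwa [div_self hexit.2.ne'] at h

variable (B) in
/-- The total rate of the downward jumps from phase `i`. -/
noncomputable def downRate (i : Phase ℓ) : ℝ≥0∞ := ENNReal.ofReal (∑' r, B.D i r)

lemma offRate_generator_of_lt (hexit : B.ExitsFromPhaseZero) {y : QSFState ℓ}
    (h : y.1.1 < x.1.1) : offRate B.generator x y =
      kronecker x.1.1 (y.1.1 + 1) * (B.downRate x.2 * ENNReal.ofReal (B.entrance y.2)) := by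
  rw [offRate_of_ne (ne_of_level_ne h.ne')]
  obtain hlevel | hlevel := eq_or_ne x.1.1 (y.1.1 + 1)
  · rw [generator_down (by lia), hlevel, kronecker_self, one_mul, downRate]
    obtain hphase | hphase := eq_or_ne x.2 (Phase.zero ℓ)
    · rw [hphase, ← ENNReal.ofReal_mul hexit.2.le, tsum_mul_entrance hexit]
    · simp only [hexit.1 x.2 hphase, tsum_zero, ENNReal.ofReal_zero, zero_mul]
  · rw [generator_far (by lia), kronecker_of_ne hlevel, zero_mul, ENNReal.ofReal_zero]

lemma killedRate_superLevel_of_lt (hx : m < x.1.1) :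
    killedRate (superLevel ℓ m) (offRate B.generator) x = offRate B.generator x := by
  refine Set.indicator_eq_self.2 fun z hz => by_contra fun hz' => hz ?_
  rw [offRate_of_ne fun h : x = z => hz' (h ▸ hx.le : m ≤ z.1.1),
    generator_eq_zero_of_notMem_superLevel hx hz', ENNReal.ofReal_zero]

lemma tsum_ofReal_entrance (hcons : IsConservativeQMatrix B.generator)
    (hexit : B.ExitsFromPhaseZero) : ∑' j, ENNReal.ofReal (B.entrance j) = 1 := by
  have h := hasSum_entrance hcons hexit
  rw [← ENNReal.ofReal_tsum_of_nonneg (entrance_nonneg hcons) h.summable, h.tsum_eq,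
    ENNReal.ofReal_one]

lemma downRate_add_aboveRate (hcons : IsConservativeQMatrix B.generator)
    (hexit : B.ExitsFromPhaseZero) (hm : m ≤ 0) (hx : m < x.1.1) :
    kronecker x.1.1 (m + 1) * B.downRate x.2 + B.aboveRate (m + 1) x = exitRate B.generator x := by
  have h := tsum_killedRate_superLevel_mul (B := B) hm x 1 1
  simp only [Pi.one_apply, ite_self, mul_one, killedRate_superLevel_of_lt hx,
    hcons.tsum_offRate] at h
  rw [h]
  congr 1
  simp only [offRate_generator_of_lt hexit (y := (⟨m, hm⟩, _)) hx, ENNReal.tsum_mul_left,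
    tsum_ofReal_entrance hcons hexit, mul_one]

end Flow

section CensoredGenerator

lemma Qcheck_eq (i j : Phase ℓ) : B.Qcheck i j = B.W i j + B.upRate 1 i * B.entrance j := by
  simp only [Qcheck, upRate, tsum_mul_right]

section Signs

variable (hcons : IsConservativeQMatrix B.generator)
include hcons

lemma upRate_one_mul_entrance_nonneg (i j : Phase ℓ) : 0 ≤ B.upRate 1 i * B.entrance j :=
  mul_nonneg (upRate_nonneg hcons le_rfl i) (entrance_nonneg hcons j)

lemma Qcheck_nonneg {i j : Phase ℓ} (hij : i ≠ j) : 0 ≤ B.Qcheck i j := by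
  rw [Qcheck_eq]
  exact add_nonneg (W_nonneg hcons hij) (upRate_one_mul_entrance_nonneg hcons i j)

lemma offRate_Qcheck_add (i j : Phase ℓ) : offRate B.Qcheck i j +
      kronecker i j * ENNReal.ofReal (B.upRate 1 i * B.entrance j) =
    offRate B.W i j + ENNReal.ofReal (B.upRate 1 i * B.entrance j) := by
  obtain rfl | h := eq_or_ne i j
  · rw [offRate_self, offRate_self, kronecker_self, one_mul]
  · rw [offRate_of_ne h, offRate_of_ne h, kronecker_of_ne h, zero_mul, add_zero, Qcheck_eq,
      ENNReal.ofReal_add (W_nonneg hcons h) (upRate_one_mul_entrance_nonneg hcons i j)]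

end Signs

variable (hcons : IsConservativeQMatrix B.generator) (hhom : B.HomogeneousConservative)
  (hexit : B.ExitsFromPhaseZero)
include hcons hhom hexit

lemma hasSum_Qcheck (i : Phase ℓ) : HasSum (B.Qcheck i) (-∑' r, B.D i r) := by
  have h := (summable_W hcons i).hasSum.add ((hasSum_entrance hcons hexit).mul_left (B.upRate 1 i))
  have hrow : ∑' r, B.W i r + B.upRate 1 i = -∑' r, B.D i r := by
    rw [upRate_one hhom]
    ring
  rw [mul_one, hrow] at h
  exact h.congr_fun fun j => Qcheck_eq i j

lemma Qcheck_diag_nonpos (i : Phase ℓ) : B.Qcheck i i ≤ 0 :=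
  (diag_le_of_hasSum (fun _ => Qcheck_nonneg hcons) (hasSum_Qcheck hcons hhom hexit i)).trans
    (neg_nonpos.2 (tsum_nonneg (D_nonneg hcons i)))

lemma tsum_offRate_Qcheck_add (i : Phase ℓ) :
    ∑' j, offRate B.Qcheck i j + B.downRate i = exitRate B.Qcheck i :=
  tsum_offRate_add (fun _ => Qcheck_nonneg hcons) (tsum_nonneg (D_nonneg hcons i))
    (hasSum_Qcheck hcons hhom hexit i)

lemma exitRate_Qcheck_add (i : Phase ℓ) :
    exitRate B.Qcheck i + ENNReal.ofReal (B.upRate 1 i * B.entrance i) = exitRate B.W i := by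
  rw [exitRate, exitRate, ← ENNReal.ofReal_add
    (neg_nonneg.2 (Qcheck_diag_nonpos hcons hhom hexit i))
    (upRate_one_mul_entrance_nonneg hcons i i), Qcheck_eq]
  ring_nf

end CensoredGenerator

section CensoredPaths

variable {x y : QSFState ℓ}

lemma offRate_generator_same (hx : x.1.1 < 0) (h : y.1.1 = x.1.1) :
    offRate B.generator x y = offRate B.W x.2 y.2 := by
  obtain hxy | hxy := eq_or_ne x.2 y.2
  · rw [show x = y from Prod.ext (Subtype.ext h.symm) hxy, offRate_self, offRate_self]
  · rw [offRate_of_ne fun hxy' => hxy (congrArg Prod.snd hxy'), offRate_of_ne hxy,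
      generator_same h hx]

variable (B) in
/-- Phase `j` can be reached from phase `i` by jumps of positive rate of `Q̌`. -/
def CheckReaches : Phase ℓ → Phase ℓ → Prop :=
  Relation.ReflTransGen fun b c => offRate B.Qcheck b c ≠ 0

lemma entrance_pos_of_offRate_ne_zero (hexit : B.ExitsFromPhaseZero) (hxy : y.1.1 < x.1.1)
    (h : offRate B.generator x y ≠ 0) :
    x.1.1 = y.1.1 + 1 ∧ x.2 = Phase.zero ℓ ∧ 0 < B.entrance y.2 := by
  rw [offRate_generator_of_lt hexit hxy] at h
  refine ⟨?_, ?_, ?_⟩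
  · by_contra hlevel
    exact h (by rw [kronecker_of_ne hlevel, zero_mul])
  · by_contra hphase
    exact h (by simp only [downRate, hexit.1 _ hphase, tsum_zero, ENNReal.ofReal_zero, zero_mul,
      mul_zero])
  · exact ENNReal.ofReal_pos.1 (right_ne_zero_of_mul (right_ne_zero_of_mul h)).bot_lt

variable (hcons : IsConservativeQMatrix B.generator)
include hcons

lemma checkReaches_of_rate_ne_zero {i j : Phase ℓ}
    (h : offRate B.W i j + ENNReal.ofReal (B.upRate 1 i * B.entrance j) ≠ 0) :
    B.CheckReaches i j := by
  obtain rfl | hij := eq_or_ne i j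
  · exact .refl
  · rw [← offRate_Qcheck_add hcons, kronecker_of_ne hij, zero_mul, add_zero] at h
    exact .single h

lemma upRate_one_pos_of_offRate_ne_zero (hhom : B.HomogeneousConservative) (hx : x.1.1 < 0)
    (hxy : x.1.1 < y.1.1) (h : offRate B.generator x y ≠ 0) : 0 < B.upRate 1 x.2 := by
  have hle : offRate B.generator x y ≤ ENNReal.ofReal (B.upRate 1 x.2) := by
    rw [← show (x.1.1 + 1 - x.1.1).toNat = 1 by lia, ← aboveRate_of_le hcons hhom hx le_rfl,
      aboveRate, ← Set.indicator_of_mem (show y ∈ superLevel ℓ (x.1.1 + 1) from hxy)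
        (offRate B.generator x)]
    exact ENNReal.le_tsum y
  exact ENNReal.ofReal_pos.1 (h.bot_lt.trans_le hle)

variable (B) in
/-- A state of level at least `-1` is shadowed from phase `i` if the process with `q`-matrix `Q̌`
started in `i` can reach the phase of `x` or, if `x` has level `0`, every phase in which level `-1`
can be entered from above. -/
def Shadows (i : Phase ℓ) (x : QSFState ℓ) : Prop :=
  (x.1.1 = -1 ∧ B.CheckReaches i x.2) ∨
    (x.1.1 = 0 ∧ ∀ j, 0 < B.entrance j → B.CheckReaches i j)

lemma Shadows.step (hhom : B.HomogeneousConservative) (hexit : B.ExitsFromPhaseZero) {i : Phase ℓ}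
    (hx : B.Shadows i x) (h : offRate B.generator x y ≠ 0) :
    B.CheckReaches i (Phase.zero ℓ) ∨ B.Shadows i y := by
  have hy := y.1.2
  obtain ⟨hlevel, hreach⟩ | ⟨hlevel, hreach⟩ := hx
  · obtain hlt | heq | hgt := lt_trichotomy y.1.1 x.1.1
    · obtain ⟨-, hphase, -⟩ := entrance_pos_of_offRate_ne_zero hexit hlt h
      exact .inl (hphase ▸ hreach)
    · rw [offRate_generator_same (by lia) heq] at h
      exact .inr (.inl ⟨by lia, hreach.trans
        (checkReaches_of_rate_ne_zero hcons fun h0 => h (add_eq_zero.1 h0).1)⟩)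
    · have hup := upRate_one_pos_of_offRate_ne_zero hcons hhom (by lia) hgt h
      exact .inr (.inr ⟨by lia, fun j hj => hreach.trans (checkReaches_of_rate_ne_zero hcons
        fun h0 => (ENNReal.ofReal_pos.2 (mul_pos hup hj)).ne' (add_eq_zero.1 h0).2)⟩)
  · obtain hlt | heq := lt_or_eq_of_le hy
    · obtain ⟨hlevel', -, hentrance⟩ :=
        entrance_pos_of_offRate_ne_zero hexit (by lia) h
      exact .inr (.inl ⟨by lia, hreach _ hentrance⟩)
    · exact .inr (.inr ⟨heq, hreach⟩)

lemma checkReaches_zero (hhom : B.HomogeneousConservative) (hexit : B.ExitsFromPhaseZero)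
    (hirr : IsIrreducibleQMatrix B.generator) (i : Phase ℓ) :
    B.CheckReaches i (Phase.zero ℓ) := by
  have hend : ∀ y, Relation.ReflTransGen (fun b c => offRate B.generator b c ≠ 0)
      (⟨-1, by lia⟩, i) y → B.CheckReaches i (Phase.zero ℓ) ∨ B.Shadows i y := by
    intro y hy
    induction hy with
    | refl => exact .inr (.inl ⟨rfl, .refl⟩)
    | tail _ hstep ih => exact ih.elim .inl fun h => h.step hcons hhom hexit hstep
  exact (hend _ (isIrreducibleRate_offRate hirr _ (⟨-2, by lia⟩, i))).resolve_right
    (by simp [Shadows])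

end CensoredPaths

section CensoredSojourn

variable (hcons : IsConservativeQMatrix B.generator) (hhom : B.HomogeneousConservative)
  (hexit : B.ExitsFromPhaseZero) (hirr : IsIrreducibleQMatrix B.generator)
include hcons hhom hexit

lemma meanSojourn_Qcheck (i j : Phase ℓ) :
    meanSojourn B.Qcheck i j = green (offRate B.Qcheck) (exitRate B.Qcheck) i j :=
  meanSojourn_eq_green (Qcheck_diag_nonpos hcons hhom hexit) i j

include hirr

lemma exitRate_Qcheck_ne_zero (i : Phase ℓ) : exitRate B.Qcheck i ≠ 0 := fun h => by
  rw [← tsum_offRate_Qcheck_add hcons hhom hexit, add_eq_zero, ENNReal.tsum_eq_zero] at h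
  obtain rfl | ⟨j, hij, -⟩ := (checkReaches_zero hcons hhom hexit hirr i).cases_head
  · exact (ENNReal.ofReal_pos.2 hexit.2).ne' h.2
  · exact hij (h.1 j)

lemma meanSojourn_Qcheck_ne_top (i j : Phase ℓ) : meanSojourn B.Qcheck i j ≠ ⊤ := by
  rw [meanSojourn_Qcheck hcons hhom hexit]
  have h0 := exitRate_Qcheck_ne_zero hcons hhom hexit hirr
  refine green_ne_top_of_path h0 exitRate_ne_top i (checkReaches_zero hcons hhom hexit hirr j) ?_
  have hsuper : ∀ k, B.downRate (Phase.zero ℓ) * kronecker k (Phase.zero ℓ) +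
      ∑' r, offRate B.Qcheck k r * 1 ≤ exitRate B.Qcheck k * 1 := fun k => by
    simp only [mul_one]
    rw [← tsum_offRate_Qcheck_add hcons hhom hexit, add_comm]
    gcongr
    obtain rfl | hk := eq_or_ne k (Phase.zero ℓ)
    · rw [kronecker_self, mul_one]
    · rw [kronecker_of_ne hk, mul_zero]
      exact zero_le
  have hpos : B.downRate (Phase.zero ℓ) ≠ 0 := (ENNReal.ofReal_pos.2 hexit.2).ne'
  intro htop
  have hle := mul_green_le_of_superharmonic h0 exitRate_ne_top hsuper i
  rw [htop, ENNReal.mul_top hpos] at hle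
  exact ENNReal.one_ne_top (top_le_iff.1 hle)

lemma meanSojourn_Qcheck_le_diag (i j : Phase ℓ) :
    meanSojourn B.Qcheck i j ≤ meanSojourn B.Qcheck j j := by
  simp only [meanSojourn_Qcheck hcons hhom hexit]
  refine green_le_diag (exitRate_Qcheck_ne_zero hcons hhom hexit hirr) exitRate_ne_top
    (fun k => ?_) i j
  rw [← tsum_offRate_Qcheck_add hcons hhom hexit]
  exact le_self_add

lemma isMatrixInverse_Qcheck : IsMatrixInverse B.Qcheck (qInverse B.Qcheck) :=
  isMatrixInverse_qInverse (Qcheck_diag_nonpos hcons hhom hexit) (fun _ _ => Qcheck_nonneg hcons)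
    (exitRate_Qcheck_ne_zero hcons hhom hexit hirr)
    (meanSojourn_Qcheck_ne_top hcons hhom hexit hirr)

lemma exitRate_W_mul_meanSojourn_Qcheck (i j : Phase ℓ) :
    exitRate B.W i * meanSojourn B.Qcheck i j = kronecker i j +
      (∑' k, offRate B.W i k * meanSojourn B.Qcheck k j + ENNReal.ofReal (B.upRate 1 i) *
        ∑' k, ENNReal.ofReal (B.entrance k) * meanSojourn B.Qcheck k j) := by
  have hback := green_backward (a := offRate B.Qcheck)
    (exitRate_Qcheck_ne_zero hcons hhom hexit hirr) exitRate_ne_top i j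
  simp only [← meanSojourn_Qcheck hcons hhom hexit] at hback
  rw [← exitRate_Qcheck_add hcons hhom hexit, add_mul, hback, add_assoc,
    ← tsum_kronecker_mul
      (fun k => ENNReal.ofReal (B.upRate 1 i * B.entrance k) * meanSojourn B.Qcheck k j) i,
    ← ENNReal.tsum_mul_left, ← ENNReal.tsum_add, ← ENNReal.tsum_add]
  congr 1
  refine tsum_congr fun k => ?_
  rw [← mul_assoc, ← add_mul, offRate_Qcheck_add hcons, add_mul,
    ENNReal.ofReal_mul (upRate_nonneg hcons le_rfl i), mul_assoc]

end CensoredSojourn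

section Excursions

variable {m : ℤ} {x : QSFState ℓ}

variable (B) in
/-- The expected total time spent in `(m, j)` before a level below `m` is reached, for the process
started in a state of level at least `m`, expressed by the sojourn times of `Q̌`: from above level
`m`, that level is entered with the distribution `entrance`. -/
noncomputable def excursionSojourn (m : ℤ) (j : Phase ℓ) (z : QSFState ℓ) : ℝ≥0∞ :=
  if z.1.1 = m then meanSojourn B.Qcheck z.2 j
  else ∑' i, ENNReal.ofReal (B.entrance i) * meanSojourn B.Qcheck i j

lemma tsum_killedRate_mul_excursionSojourn (hm : m ≤ 0) (x : QSFState ℓ) (j : Phase ℓ) :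
    ∑' z, killedRate (superLevel ℓ m) (offRate B.generator) x z * B.excursionSojourn m j z =
      ∑' i, offRate B.generator x (⟨m, hm⟩, i) * meanSojourn B.Qcheck i j +
        B.aboveRate (m + 1) x * ∑' i, ENNReal.ofReal (B.entrance i) * meanSojourn B.Qcheck i j :=
  tsum_killedRate_superLevel_mul hm x (fun i => meanSojourn B.Qcheck i j) _

variable (hcons : IsConservativeQMatrix B.generator) (hhom : B.HomogeneousConservative)
  (hexit : B.ExitsFromPhaseZero) (hirr : IsIrreducibleQMatrix B.generator)

include hcons hexit in
lemma excursionSojourn_backward_above (hm : m ≤ 0) (hx : m < x.1.1) (j : Phase ℓ) :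
    exitRate B.generator x * B.excursionSojourn m j x = kronecker x (⟨m, hm⟩, j) +
      ∑' z, killedRate (superLevel ℓ m) (offRate B.generator) x z * B.excursionSojourn m j z := by
  rw [tsum_killedRate_mul_excursionSojourn hm, kronecker_of_ne (ne_of_level_ne hx.ne'), zero_add,
    excursionSojourn, if_neg hx.ne', ← downRate_add_aboveRate hcons hexit hm hx, add_mul]
  simp only [offRate_generator_of_lt hexit (y := (⟨m, hm⟩, _)) hx, mul_assoc,
    ENNReal.tsum_mul_left]

include hcons hhom hexit hirr

lemma excursionSojourn_backward_level (hm : m < 0) (i j : Phase ℓ) :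
    exitRate B.generator (⟨m, hm.le⟩, i) * B.excursionSojourn m j (⟨m, hm.le⟩, i) =
      kronecker (S := QSFState ℓ) (⟨m, hm.le⟩, i) (⟨m, hm.le⟩, j) +
        ∑' z, killedRate (superLevel ℓ m) (offRate B.generator) (⟨m, hm.le⟩, i) z *
          B.excursionSojourn m j z := by
  have hkronecker : kronecker (S := QSFState ℓ) (⟨m, hm.le⟩, i) (⟨m, hm.le⟩, j) =
      kronecker i j := by
    obtain rfl | hij := eq_or_ne i j
    · rw [kronecker_self, kronecker_self]
    · rw [kronecker_of_ne hij, kronecker_of_ne fun h => hij (congrArg Prod.snd h)]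
  have hrate : exitRate B.generator (⟨m, hm.le⟩, i) = exitRate B.W i := by
    rw [exitRate, generator_same rfl hm, exitRate]
  have hoff (k : Phase ℓ) :
      offRate B.generator (⟨m, hm.le⟩, i) (⟨m, hm.le⟩, k) = offRate B.W i k :=
    offRate_generator_same hm rfl
  rw [tsum_killedRate_mul_excursionSojourn hm.le, aboveRate_of_le hcons hhom hm le_rfl, hkronecker,
    hrate, excursionSojourn, if_pos rfl, show (m + 1 - m).toNat = 1 by lia,
    exitRate_W_mul_meanSojourn_Qcheck hcons hhom hexit hirr]
  simp only [hoff]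

lemma excursionSojourn_le (j : Phase ℓ) (z : QSFState ℓ) :
    B.excursionSojourn m j z ≤ meanSojourn B.Qcheck j j := by
  have hle := fun i => meanSojourn_Qcheck_le_diag hcons hhom hexit hirr i j
  unfold excursionSojourn
  split_ifs
  · exact hle z.2
  · calc ∑' i, ENNReal.ofReal (B.entrance i) * meanSojourn B.Qcheck i j
        ≤ ∑' i, ENNReal.ofReal (B.entrance i) * meanSojourn B.Qcheck j j := by
          gcongr with i
          exact hle i
      _ = meanSojourn B.Qcheck j j := by
          rw [ENNReal.tsum_mul_right, tsum_ofReal_entrance hcons hexit, one_mul]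

variable (hrec : IsRecurrent (offRate B.generator) (exitRate B.generator))
include hrec

lemma excursionSojourn_eq_green (hm : m < 0) (j : Phase ℓ) (hx : x ∈ superLevel ℓ m) :
    B.excursionSojourn m j x = green (killedRate (superLevel ℓ m) (offRate B.generator))
      (exitRate B.generator) x (⟨m, hm.le⟩, j) := by
  refine eq_green_killedRate (fun z => hcons.exitRate_ne_zero z hirr) exitRate_ne_top
    offRate_ne_top hcons.tsum_offRate hrec (isIrreducibleRate_offRate hirr)
    (x₀ := (⟨m - 1, by lia⟩, j)) (by simp [superLevel])
    (meanSojourn_Qcheck_ne_top hcons hhom hexit hirr j j)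
    (excursionSojourn_le hcons hhom hexit hirr j) (fun z hz => ?_) hx
  obtain hlt | heq := lt_or_eq_of_le (show m ≤ z.1.1 from hz)
  · exact excursionSojourn_backward_above hcons hexit hm.le hlt j
  · obtain ⟨⟨k, hk⟩, i⟩ := z
    obtain rfl : m = k := heq
    exact excursionSojourn_backward_level hcons hhom hexit hirr hm i j

end Excursions

section RateMatrix

variable {m : ℤ}

lemma Acheck_eq (x : subLevel ℓ (m - 1)) (j : Phase ℓ) : B.Acheck m x j =
    B.U (m - x.1.1.1).toNat x.1.2 j +
      B.upRate (m + 1 - x.1.1.1).toNat x.1.2 * B.entrance j := by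
  simp only [Acheck, upRate, tsum_mul_right]

lemma rateMatrix_eq (x : subLevel ℓ (m - 1)) (j : Phase ℓ) :
    B.rateMatrix m x j = ∑' i, B.Acheck m x i * (meanSojourn B.Qcheck i j).toReal := by
  simp only [rateMatrix, qInverse, mul_neg, tsum_neg, neg_neg]

lemma compl_superLevel : (superLevel ℓ m)ᶜ = subLevel ℓ (m - 1) := by
  ext x
  simp only [superLevel, subLevel, Set.mem_compl_iff, Set.mem_ofPred_eq]
  lia

variable (hcons : IsConservativeQMatrix B.generator)
include hcons

lemma U_toNat_nonneg (x : subLevel ℓ (m - 1)) (j : Phase ℓ) :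
    0 ≤ B.U (m - x.1.1.1).toNat x.1.2 j := by
  have hx : x.1.1.1 ≤ m - 1 := x.2
  exact U_nonneg hcons (by lia) _ _

lemma upRate_toNat_nonneg (x : subLevel ℓ (m - 1)) :
    0 ≤ B.upRate (m + 1 - x.1.1.1).toNat x.1.2 := by
  have hx : x.1.1.1 ≤ m - 1 := x.2
  exact upRate_nonneg hcons (by lia) _

lemma Acheck_nonneg (x : subLevel ℓ (m - 1)) (j : Phase ℓ) : 0 ≤ B.Acheck m x j := by
  rw [Acheck_eq]
  exact add_nonneg (U_toNat_nonneg hcons x j)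
    (mul_nonneg (upRate_toNat_nonneg hcons x) (entrance_nonneg hcons j))

lemma rateMatrix_nonneg (x : subLevel ℓ (m - 1)) (j : Phase ℓ) : 0 ≤ B.rateMatrix m x j := by
  rw [rateMatrix_eq]
  exact tsum_nonneg fun i => mul_nonneg (Acheck_nonneg hcons x i) ENNReal.toReal_nonneg

variable (hexit : B.ExitsFromPhaseZero)
include hexit

lemma summable_Acheck (hm : m < 0) (x : subLevel ℓ (m - 1)) : Summable (B.Acheck m x) := by
  have hx : x.1.1.1 ≤ m - 1 := x.2
  refine ((summable_generator_level hcons x.1 ⟨m, hm.le⟩).add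
    ((hasSum_entrance hcons hexit).summable.mul_left
      (B.upRate (m + 1 - x.1.1.1).toNat x.1.2))).congr fun j => ?_
  rw [Acheck_eq, generator_up (by dsimp only; lia) hm]

variable (hhom : B.HomogeneousConservative) (hirr : IsIrreducibleQMatrix B.generator)
include hhom hirr

lemma summable_Acheck_mul (hm : m < 0) (x : subLevel ℓ (m - 1)) (j : Phase ℓ) :
    Summable fun i => B.Acheck m x i * (meanSojourn B.Qcheck i j).toReal := by
  have hA := Acheck_nonneg hcons x
  have hle (i : Phase ℓ) :
      (meanSojourn B.Qcheck i j).toReal ≤ (meanSojourn B.Qcheck j j).toReal :=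
    ENNReal.toReal_mono (meanSojourn_Qcheck_ne_top hcons hhom hexit hirr j j)
      (meanSojourn_Qcheck_le_diag hcons hhom hexit hirr i j)
  exact .of_nonneg_of_le (fun i => mul_nonneg (hA i) ENNReal.toReal_nonneg)
    (fun i => mul_le_mul_of_nonneg_left (hle i) (hA i))
    ((summable_Acheck hcons hexit hm x).mul_right _)

lemma ofReal_rateMatrix (hm : m < 0) (x : subLevel ℓ (m - 1)) (j : Phase ℓ) :
    ENNReal.ofReal (B.rateMatrix m x j) =
      ∑' i, ENNReal.ofReal (B.Acheck m x i) * meanSojourn B.Qcheck i j := by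
  have hA := Acheck_nonneg hcons x
  rw [rateMatrix_eq, ENNReal.ofReal_tsum_of_nonneg
    (fun i => mul_nonneg (hA i) ENNReal.toReal_nonneg)
    (summable_Acheck_mul hcons hexit hhom hirr hm x j)]
  refine tsum_congr fun i => ?_
  rw [ENNReal.ofReal_mul (hA i),
    ENNReal.ofReal_toReal (meanSojourn_Qcheck_ne_top hcons hhom hexit hirr i j)]

variable (hrec : IsRecurrent (offRate B.generator) (exitRate B.generator))
include hrec

/-- An excursion from `x` into the levels at least `m` starts either in level `m` or above it, and
in the latter case first meets level `m` with the distribution `entrance`. -/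
lemma exitRate_mul_green_superLevel (hm : m < 0) (x : subLevel ℓ (m - 1)) (j : Phase ℓ) :
    exitRate B.generator x.1 * green (killedRate (superLevel ℓ m) (offRate B.generator))
      (exitRate B.generator) x.1 (⟨m, hm.le⟩, j) = ENNReal.ofReal (B.rateMatrix m x j) := by
  have hx : x.1.1.1 ≤ m - 1 := x.2
  have hlt : x.1.1.1 < m := by lia
  have hne (i : Phase ℓ) : x.1 ≠ (⟨m, hm.le⟩, i) := ne_of_level_ne hlt.ne
  rw [green_backward (fun z => hcons.exitRate_ne_zero z hirr) exitRate_ne_top,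
    kronecker_of_ne (hne j), zero_add,
    tsum_killedRate_mul_congr (fun z hz =>
      (excursionSojourn_eq_green hcons hhom hexit hirr hrec hm j hz).symm),
    tsum_killedRate_mul_excursionSojourn hm.le, aboveRate_of_le hcons hhom hm hlt.le,
    ofReal_rateMatrix hcons hexit hhom hirr hm, ← ENNReal.tsum_mul_left, ← ENNReal.tsum_add]
  refine tsum_congr fun i => ?_
  rw [offRate_of_ne (hne i), generator_up hlt hm, Acheck_eq, ← mul_assoc, ← add_mul,
    ← ENNReal.ofReal_mul (upRate_toNat_nonneg hcons x), ENNReal.ofReal_add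
      (U_toNat_nonneg hcons x i)
      (mul_nonneg (upRate_toNat_nonneg hcons x) (entrance_nonneg hcons i))]

lemma hasSum_rateMatrix {p : QSFState ℓ → ℝ} (hp0 : ∀ x, 0 ≤ p x)
    (hp : ∀ y, ∑' x, ENNReal.ofReal (p x) * offRate B.generator x y =
      ENNReal.ofReal (p y) * exitRate B.generator y) (hm : m < 0) (j : Phase ℓ) :
    HasSum (fun x : subLevel ℓ (m - 1) => p x.1 * B.rateMatrix m x j) (p (⟨m, hm.le⟩, j)) := by
  have hbalance : ∑' x : subLevel ℓ (m - 1), ENNReal.ofReal (p x.1 * B.rateMatrix m x j) =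
      ENNReal.ofReal (p (⟨m, hm.le⟩, j)) := by
    rw [← tsum_mul_green_killedRate (F := superLevel ℓ m) (fun z => hcons.exitRate_ne_zero z hirr)
      exitRate_ne_top offRate_ne_top hrec (isIrreducibleRate_offRate hirr)
      (fun x => ENNReal.ofReal_ne_top) hp (x₀ := (⟨m - 1, by lia⟩, j)) (by simp [superLevel])
      (⟨m, hm.le⟩, j), compl_superLevel]
    refine tsum_congr fun x => ?_
    rw [exitRate_mul_green_superLevel hcons hexit hhom hirr hrec hm,
      ENNReal.ofReal_mul (hp0 _)]
  have h := ENNReal.hasSum_toReal (hbalance.trans_ne ENNReal.ofReal_ne_top)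
  rw [← ENNReal.tsum_toReal_eq (fun _ => ENNReal.ofReal_ne_top), hbalance,
    ENNReal.toReal_ofReal (hp0 _)] at h
  exact h.congr_fun fun x =>
    (ENNReal.toReal_ofReal (mul_nonneg (hp0 _) (rateMatrix_nonneg hcons x j))).symm

end RateMatrix

end QSFBlocks

theorem mainTheorem3_general (ℓ : ℕ∞) (B : QSFBlocks ℓ)
    (hcons : IsConservativeQMatrix B.generator)
    (hhom : B.HomogeneousConservative)
    (hirr : IsIrreducibleQMatrix B.generator)
    (hexit : IsExitState B.generator (QSFBlocks.superLevel ℓ 0) (⟨0, le_rfl⟩, Phase.zero ℓ))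
    (hrec : ∀ x, meanSojourn B.generator x x = ⊤)
    (p : QSFState ℓ → ℝ) (hp0 : ∀ x, 0 ≤ p x)
    (hp : ∀ t : ℝ, 0 ≤ t → ∀ y, ∑' x, ENNReal.ofReal (p x) *
      minimalTransition B.generator t x y = ENNReal.ofReal (p y)) :
    (∀ i j, meanSojourn B.Qcheck i j ≠ ⊤) ∧
    IsMatrixInverse B.Qcheck (qInverse B.Qcheck) ∧
    (ℓ ≠ ⊤ → ∀ N, IsMatrixInverse B.Qcheck N → N = qInverse B.Qcheck) ∧
    ∀ (m : ℤ) (hm : m < 0) (j : Phase ℓ),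
      (∀ x : QSFBlocks.subLevel ℓ (m - 1),
        Summable (fun i => B.Acheck m x i * qInverse B.Qcheck i j)) ∧
      HasSum (fun x : QSFBlocks.subLevel ℓ (m - 1) => p x.1 * B.rateMatrix m x j)
        (p (⟨m, hm.le⟩, j)) := by
  have hzero := QSFBlocks.exitsFromPhaseZero hcons hexit
  have hinv := QSFBlocks.isMatrixInverse_Qcheck hcons hhom hzero hirr
  have hbalance := tsum_mul_offRate_of_invariant hcons.diag_nonpos
    (fun _ => ENNReal.ofReal_ne_top) hp
  refine ⟨QSFBlocks.meanSojourn_Qcheck_ne_top hcons hhom hzero hirr, hinv, fun hl N hN => ?_,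
    fun m hm j => ⟨fun x => ?_, QSFBlocks.hasSum_rateMatrix hcons hzero hhom hirr
      (fun x => (meanSojourn_eq_green hcons.diag_nonpos x x).symm.trans (hrec x))
      hp0 hbalance hm j⟩⟩
  · have := finite_phase hl
    exact hN.eq_of_finite hinv
  · simp only [qInverse, mul_neg]
    exact (QSFBlocks.summable_Acheck_mul hcons hzero hhom hirr hm x j).neg

theorem mainTheorem3 (ℓ : ℕ∞) (B : QSFBlocks ℓ)
    (hcons : IsConservativeQMatrix B.generator)
    (hhom : B.HomogeneousConservative)
    (hirr : IsIrreducibleQMatrix B.generator)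
    (hexit : ∀ (m : ℤ) (hm : m ≤ 0),
      IsExitState B.generator (QSFBlocks.superLevel ℓ m) (⟨m, hm⟩, Phase.zero ℓ))
    (p : QSFState ℓ → ℝ) (hp : IsStationaryDistribution B.generator p) :
    (∀ i j, meanSojourn B.Qcheck i j ≠ ⊤) ∧
    IsMatrixInverse B.Qcheck (qInverse B.Qcheck) ∧
    (ℓ ≠ ⊤ → ∀ N, IsMatrixInverse B.Qcheck N → N = qInverse B.Qcheck) ∧
    ∀ (m : ℤ) (hm : m < 0) (j : Phase ℓ),
      (∀ x : QSFBlocks.subLevel ℓ (m - 1),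
        Summable (fun i => B.Acheck m x i * qInverse B.Qcheck i j)) ∧
      HasSum (fun x : QSFBlocks.subLevel ℓ (m - 1) => p x.1 * B.rateMatrix m x j)
        (p (⟨m, hm.le⟩, j)) := by
  exact mainTheorem3_general ℓ B hcons hhom hirr (hexit 0 le_rfl)
    (hp.meanSojourn_diag_eq_top hcons hirr) p hp.1 hp.2.2
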